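/- **Setting.** Let $\mathcal X$ be a measurable space, $\mathcal F$ a class of hypotheses $f:\mathcal X\to\{0,1\}$ of finite VC dimension $d$, and $D_1,\dots,D_k$ ($k\ge 2$) probability distributions on $\mathcal X\times\{0,1\}$. Write $\mathrm{err}_D(f)=\Pr_{(x,y)\sim D}[f(x)\ne y]$ and, for a finite sample $S$, let $\mathrm{err}_S(f)$ be the fraction of examples of $S$ that $f$ mislabels. Assume realizability: some $f^*\in\mathcal F$ has $\mathrm{err}_{D_i}(f^*)=0$ for all $i\in[k]$. Let $\mathcal O_{\mathcal F}$ be an empirical risk minimizer: it maps every finite sample $S$ to some $f\in\mathcal F$ with the smallest $\mathrm{err}_S(f)$ over $\mathcal F$, and the label $\mathcal O_{\mathcal F}(S)(x)$ is a jointly measurable function of $(S,x)$. **Algorithm R1** (with parameters $\epsilon,\delta\in(0,1)$ and constants $C,c>0$). Put $t=5\lceil\log_2 k\rceil$, $\epsilon'=\epsilon/6$, $\delta'=\delta/(3t)$, $w^{(0)}_i=1$ for $i\in[k]$, and $m_{\alpha,\beta}=\left\lceil\frac{C}{\alpha}\left(d\ln\frac1\alpha+\ln\frac1\beta\right)\right\rceil$.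 In round $r=1,\dots,t$: 1. draw a sample $S^{(r)}$ of $m_{\epsilon'/16,\delta'}$ independent examples from the mixture $\frac{1}{\Phi}\sum_i w^{(r-1)}_iD_i$, where $\Phi=\sum_i w^{(r-1)}_i$, and let $f^{(r)}=\mathcal O_{\mathcal F}(S^{(r)})$; 2. for each $i\in[k]$ draw a fresh sample $T_i$ of $\left\lceil\frac{c}{\epsilon'}\ln\frac{k}{\delta'}\right\rceil$ independent examples from $D_i$; player $i$ passes the test if $\mathrm{err}_{T_i}(f^{(r)})\le\frac34\epsilon'$; 3. let $w_i^{(r)}=w_i^{(r-1)}$ if $i$ passes and $w_i^{(r)}=2w_i^{(r-1)}$ otherwise. Return the majority vote $f_{\mathrm{R1}}$ of $f^{(1)},\dots,f^{(t)}$ (ties give the label $0$). **Theorem.** There is an absolute constant $C_0>0$ such that for all constants $C\ge C_0$ and $c\ge 32$ the following hold. (a) For all $\mathcal X,\mathcal F,d,\mathcal O_{\mathcal F},k,D_1,\dots,D_k$ as above and all $\epsilon,\delta\in(0,1)$, with probability at least $1-\delta$ Algorithm R1 returns a classifier with $\mathrm{err}_{D_i}(f_{\mathrm{R1}})\le\epsilon$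 for every $i\in[k]$. (b) The number of examples that Algorithm R1 draws is $$O\left(\frac{\ln k}{\epsilon}\left(d\ln\frac1\epsilon+k\ln\frac k\delta\right)\right)$$ as long as $\epsilon$ is bounded away from $1$: for every $\epsilon_0\in(0,1)$ there is a constant $K$, depending only on $\epsilon_0$, $C$ and $c$, such that for all $d\ge 0$, $k\ge2$, $\epsilon\in(0,\epsilon_0]$ and $\delta\in(0,1)$ this number is at most $K\,\frac{\ln k}{\epsilon}\left(d\ln\frac1\epsilon+k\ln\frac k\delta\right)$. -/

import Mathlib

open MeasureTheory
open scoped NNReal ENNReal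

namespace CollabPAC

/-! ### Hypotheses, errors, VC dimension -/

/-- A labelled example: an instance of `X` with a label in `{0, 1}` (`false` is 0, `true` is 1). -/
abbrev Example (X : Type*) : Type _ := X × Bool

/-- `err_D(f) = Pr_{(x, y) ∼ D} [f x ≠ y]`. -/
noncomputable def err {X : Type*} [MeasurableSpace X] (D : Measure (Example X)) (f : X → Bool) : ℝ :=
  D.real {z | f z.1 ≠ z.2}

/-- `err_S(f)`: the fraction of the examples of the sample `S` that `f` mislabels. -/
noncomputable def empErr {X : Type*} {m : ℕ} (S : Fin m → Example X) (f : X → Bool) : ℝ :=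
  ((Finset.univ.filter fun j => f (S j).1 ≠ (S j).2).card : ℝ) / m

/-- The class `F` shatters the finite set `A`: every labelling of `A` is realized by a member. -/
def Shatters {X : Type*} (F : Set (X → Bool)) (A : Finset X) : Prop :=
  ∀ g : X → Bool, ∃ f ∈ F, ∀ x ∈ A, f x = g x

/-- The VC dimension: the supremum (possibly `⊤`) of the sizes of the shattered finite sets. -/
noncomputable def vcDim {X : Type*} (F : Set (X → Bool)) : ℕ∞ :=
  ⨆ (A : Finset X) (_ : Shatters F A), (A.card : ℕ∞)

/-! ### Empirical risk minimization -/

/-- A deterministic learning rule: it maps a sample of any size to a classifier. -/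
abbrev Learner (X : Type*) : Type _ := (m : ℕ) → (Fin m → Example X) → X → Bool

/-- `O` is an empirical risk minimizer over `F`: it returns a member of `F` with the smallest error
on the sample. The label that it assigns to an instance is a measurable function of the sample and
the instance, so that errors of learned classifiers are random variables. -/
structure IsERM {X : Type*} [MeasurableSpace X] (F : Set (X → Bool)) (O : Learner X) : Prop where
  mem : ∀ (m : ℕ) (S : Fin m → Example X), O m S ∈ F
  le : ∀ (m : ℕ) (S : Fin m → Example X), ∀ f ∈ F, empErr S (O m S) ≤ empErr S f
  measurable : ∀ m : ℕ, Measurable fun p : (Fin m → Example X) × X => O m p.1 p.2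

/-! ### Parameters of Algorithm R1 -/

/-- The number of rounds `t = 5 ⌈log₂ k⌉`. -/
noncomputable def rounds (k : ℕ) : ℕ := 5 * ⌈Real.logb 2 k⌉₊

/-- `ε' = ε / 6`. -/
noncomputable def eps' (ε : ℝ) : ℝ := ε / 6

/-- `δ' = δ / (3 t)`. -/
noncomputable def delta' (k : ℕ) (δ : ℝ) : ℝ := δ / (3 * rounds k)

/-- `m_{ε, δ} = (C / ε) (d ln (1 / ε) + ln (1 / δ))`, rounded up: the sample size of the
VC theorem with constant `C`. -/
noncomputable def vcSize (C : ℝ) (d : ℕ) (ε δ : ℝ) : ℕ :=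
  ⌈C / ε * (d * Real.log (1 / ε) + Real.log (1 / δ))⌉₊

/-- The size `|S^(r)| = m_{ε'/16, δ'}` of the sample from the mixture. -/
noncomputable def learnSize (C : ℝ) (d k : ℕ) (ε δ : ℝ) : ℕ :=
  vcSize C d (eps' ε / 16) (delta' k δ)

/-- The size `|T_i| = (c / ε') ln (k / δ')`, rounded up, of each player's sample in `Test`. -/
noncomputable def testSize (c : ℝ) (k : ℕ) (ε δ : ℝ) : ℕ :=
  ⌈c / eps' ε * Real.log (k / delta' k δ)⌉₊

/-! ### The random execution of the algorithm

`m` is the size of the samples `S^(r)` and `n` the size of the samples `T_i`. -/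

/-- All examples drawn in one round: the sample `S` from the mixture and, for each player `i`, the
test sample `T_i`. -/
abbrev RoundData (X : Type*) (k m n : ℕ) : Type _ :=
  (Fin m → Example X) × (Fin k → Fin n → Example X)

/-- The classifier learned in a round with data `ρ`. -/
def roundClassifier {X : Type*} {k m n : ℕ} (O : Learner X) (ρ : RoundData X k m n) : X → Bool :=
  O m ρ.1

/-- The output of `Test`: the players on whose test sample the classifier of the round has error
at most `3 ε' / 4`. -/
def passed {X : Type*} {k m n : ℕ} (O : Learner X) (ε' : ℝ) (ρ : RoundData X k m n) : Set (Fin k) :=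
  {i | empErr (ρ.2 i) (roundClassifier O ρ) ≤ 3 / 4 * ε'}

open Classical in
/-- The weights after `r` rounds with data `h`: they start at 1 and double whenever the player does
not pass the test. -/
noncomputable def weights {X : Type*} {k m n : ℕ} (O : Learner X) (ε' : ℝ) :
    (r : ℕ) → (Fin r → RoundData X k m n) → Fin k → ℝ≥0
  | 0, _, _ => 1
  | r + 1, h, i =>
    if i ∉ passed O ε' (h (Fin.last r)) then 2 * weights O ε' r (fun s => h s.castSucc) i
    else weights O ε' r (fun s => h s.castSucc) i

/-- The weighted mixture `(1 / Φ) ∑ i, w i D_i`, where `Φ = ∑ i, w i`. -/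
noncomputable def mixture {X : Type*} [MeasurableSpace X] {k : ℕ} (D : Fin k → Measure (Example X))
    (w : Fin k → ℝ≥0) : Measure (Example X) :=
  (∑ i, w i)⁻¹ • ∑ i, w i • D i

/-- The law of the data of one round when the current weights are `w`: `m` independent examples
from the mixture and, independently, `n` independent examples from every `D i`. -/
noncomputable def roundLaw {X : Type*} [MeasurableSpace X] {k : ℕ} (D : Fin k → Measure (Example X))
    (m n : ℕ) (w : Fin k → ℝ≥0) : Measure (RoundData X k m n) :=
  (Measure.pi fun _ : Fin m => mixture D w).prod
    (Measure.pi fun i : Fin k => Measure.pi fun _ : Fin n => D i)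

/-- The law of the data of the first `r` rounds: given the rounds so far, the next round is drawn
from `roundLaw` with the weights that these rounds produce. -/
noncomputable def law {X : Type*} [MeasurableSpace X] {k : ℕ} (D : Fin k → Measure (Example X))
    (O : Learner X) (m n : ℕ) (ε' : ℝ) : (r : ℕ) → Measure (Fin r → RoundData X k m n)
  | 0 => Measure.dirac Fin.elim0
  | r + 1 => (law D O m n ε' r).bind fun h =>
      (roundLaw D m n (weights O ε' r h)).map
        fun ρ => Fin.snoc (α := fun _ => RoundData X k m n) h ρ

/-! ### The law of the execution is well defined -/

lemma measurable_empErr {X : Type*} [MeasurableSpace X] {Ω : Type*} [MeasurableSpace Ω] {n : ℕ}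
    (T : Ω → Fin n → Example X) (hT : Measurable T) (f : Ω → X → Bool)
    (hf : Measurable fun p : Ω × X => f p.1 p.2) : Measurable fun ω => empErr (T ω) (f ω) := by
  unfold empErr
  refine Measurable.div_const ?_ _
  simp only [Finset.card_filter, Nat.cast_sum]
  refine Finset.measurable_sum _ fun j _ => ?_
  have h1 : Measurable fun ω => f ω (T ω j).1 :=
    hf.comp (measurable_id.prodMk ((measurable_pi_apply j).comp hT).fst)
  have h2 : Measurable fun ω => (T ω j).2 := ((measurable_pi_apply j).comp hT).snd
  exact (measurable_of_countable
    (fun b : Bool × Bool => ((if b.1 ≠ b.2 then 1 else 0 : ℕ) : ℝ))).comp (h1.prodMk h2)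

lemma measurable_passed {X : Type*} [MeasurableSpace X] {k m n : ℕ} {F : Set (X → Bool)}
    {O : Learner X} (hO : IsERM F O) (ε' : ℝ) (i : Fin k) :
    MeasurableSet {ρ : RoundData X k m n | i ∈ passed O ε' ρ} :=
  measurableSet_le
    (measurable_empErr (fun ρ : RoundData X k m n => ρ.2 i)
      ((measurable_pi_apply i).comp measurable_snd) (fun ρ => roundClassifier O ρ)
      ((hO.measurable m).comp (g := fun p : (Fin m → Example X) × X => O m p.1 p.2)
        (f := fun p : RoundData X k m n × X => (p.1.1, p.2))
        ((measurable_fst.comp measurable_fst).prodMk measurable_snd)))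
    measurable_const

open Classical in
lemma exists_weights_eq {X : Type*} [MeasurableSpace X] {k m n : ℕ} {F : Set (X → Bool)}
    {O : Learner X} (hO : IsERM F O) (ε' : ℝ) (r : ℕ) :
    ∃ e : (Fin r → RoundData X k m n) → Fin k → ℕ, Measurable e ∧
      ∀ h, weights O ε' r h = fun i => 2 ^ e h i := by
  induction r with
  | zero => exact ⟨fun _ _ => 0, measurable_const, fun h => by ext; simp [weights]⟩
  | succ r ih =>
    obtain ⟨e, he, hw⟩ := ih
    refine ⟨fun h i => if h (Fin.last r) ∈ {ρ | i ∈ passed O ε' ρ} then e (fun s => h s.castSucc) i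
      else e (fun s => h s.castSucc) i + 1, ?_, ?_⟩
    · refine measurable_pi_lambda _ fun i => ?_
      have h1 : Measurable fun h : Fin (r + 1) → RoundData X k m n =>
          e (fun s => h s.castSucc) i :=
        (measurable_pi_apply i).comp (he.comp (measurable_pi_lambda _ fun s =>
          measurable_pi_apply s.castSucc))
      exact Measurable.ite ((measurable_passed hO ε' i).preimage (measurable_pi_apply _)) h1
        (h1.add_const 1)
    · intro h
      funext i
      by_cases hi : i ∈ passed O ε' (h (Fin.last r)) <;> simp [weights, hw, hi, pow_succ, mul_comm]

lemma isProbabilityMeasure_mixture {X : Type*} [MeasurableSpace X] {k : ℕ}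
    (D : Fin k → Measure (Example X)) [∀ i, IsProbabilityMeasure (D i)] (w : Fin k → ℝ≥0)
    (hw : ∑ i, w i ≠ 0) : IsProbabilityMeasure (mixture D w) := by
  constructor
  simp only [mixture, Measure.smul_apply, Measure.coe_finsetSum, Finset.sum_apply, measure_univ,
    ENNReal.smul_def, smul_eq_mul, mul_one]
  rw [← ENNReal.ofNNReal_finsetSum, ← ENNReal.coe_mul, inv_mul_cancel₀ hw, ENNReal.coe_one]

/-- The kernels in `law` are measurable, so that `law` is a genuine probability measure. -/
theorem law_wellDefined {X : Type*} [MeasurableSpace X] {k : ℕ} (hk : k ≠ 0)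
    (D : Fin k → Measure (Example X)) [∀ i, IsProbabilityMeasure (D i)] {F : Set (X → Bool)}
    {O : Learner X} (hO : IsERM F O) (m n : ℕ) (ε' : ℝ) (r : ℕ) :
    (Measurable fun h : Fin r → RoundData X k m n =>
      (roundLaw D m n (weights O ε' r h)).map
        fun ρ => Fin.snoc (α := fun _ => RoundData X k m n) h ρ) ∧
    IsProbabilityMeasure (law D O m n ε' r) := by
  have hsnoc (r : ℕ) : Measurable fun p : (Fin r → RoundData X k m n) × RoundData X k m n =>
      (Fin.snoc (α := fun _ => RoundData X k m n) p.1 p.2 : Fin (r + 1) → RoundData X k m n) := by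
    refine measurable_pi_lambda _ fun j => ?_
    refine Fin.lastCases ?_ (fun s => ?_) j
    · simpa using measurable_snd
    · simpa [Function.comp_def] using (measurable_pi_apply s).comp measurable_fst
  have hmix (e : Fin k → ℕ) : IsProbabilityMeasure (mixture D fun i => 2 ^ e i) := by
    refine isProbabilityMeasure_mixture D _ (ne_of_gt (Finset.sum_pos (fun i _ => by positivity) ?_))
    exact ⟨⟨0, Nat.pos_of_ne_zero hk⟩, Finset.mem_univ _⟩
  have hround (e : Fin k → ℕ) : IsProbabilityMeasure (roundLaw D m n fun i => 2 ^ e i) := by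
    have := hmix e
    unfold roundLaw
    infer_instance
  have hmeas (r : ℕ) : Measurable fun h : Fin r → RoundData X k m n =>
      (roundLaw D m n (weights O ε' r h)).map
        fun ρ => Fin.snoc (α := fun _ => RoundData X k m n) h ρ := by
    obtain ⟨e, he, hw⟩ := exists_weights_eq (k := k) (m := m) (n := n) hO ε' r
    simp only [hw]
    have key : Measurable fun p : (Fin r → RoundData X k m n) × (Fin k → ℕ) =>
        (roundLaw D m n fun i => 2 ^ p.2 i).map
          fun ρ => Fin.snoc (α := fun _ => RoundData X k m n) p.1 ρ := by
      refine measurable_from_prod_countable_left fun e => ?_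
      have := hround e
      refine Measure.measurable_of_measurable_coe _ fun s hs => ?_
      have h0 (h : Fin r → RoundData X k m n) := Measure.map_apply
        (μ := roundLaw D m n fun i => 2 ^ e i) ((hsnoc r).comp (measurable_prodMk_left (x := h))) hs
      simp only [Function.comp_def] at h0
      simp only [h0]
      exact measurable_measure_prodMk_left ((hsnoc r) hs)
    exact key.comp (measurable_id.prodMk he)
  refine ⟨hmeas r, ?_⟩
  induction r with
  | zero => unfold law; infer_instance
  | succ r ih =>
    unfold law
    constructor
    rw [Measure.bind_apply MeasurableSet.univ (hmeas r).aemeasurable]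
    obtain ⟨e, he, hw⟩ := exists_weights_eq (k := k) (m := m) (n := n) hO ε' r
    have h1 (h : Fin r → RoundData X k m n) : ((roundLaw D m n (weights O ε' r h)).map
        fun ρ => Fin.snoc (α := fun _ => RoundData X k m n) h ρ) Set.univ = 1 := by
      have := hround (e h)
      rw [hw]
      have h0 := Measure.map_apply (μ := roundLaw D m n fun i => 2 ^ e h i)
        ((hsnoc r).comp (measurable_prodMk_left (x := h))) MeasurableSet.univ
      simp only [Function.comp_def] at h0
      rw [h0]
      simp
    simp [h1]

/-! ### Output and sample count -/

/-- The majority vote of `t` classifiers (ties give the label 0). -/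
def maj {X : Type*} {t : ℕ} (f : Fin t → X → Bool) : X → Bool := fun x =>
  decide (t < 2 * (Finset.univ.filter fun r => f r x = true).card)

/-- The distribution of all the data that Algorithm R1 draws when it is run with constants `C`
(learning) and `c` (testing). -/
noncomputable def lawR1 {X : Type*} [MeasurableSpace X] {k : ℕ} (D : Fin k → Measure (Example X))
    (O : Learner X) (C c : ℝ) (d : ℕ) (ε δ : ℝ) :
    Measure (Fin (rounds k) → RoundData X k (learnSize C d k ε δ) (testSize c k ε δ)) :=
  law D O (learnSize C d k ε δ) (testSize c k ε δ) (eps' ε) (rounds k)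

/-- The classifier that Algorithm R1 returns, as a function of the data drawn. -/
def outputR1 {X : Type*} {t k m n : ℕ} (O : Learner X) (h : Fin t → RoundData X k m n) : X → Bool :=
  maj fun r => roundClassifier O (h r)

/-- The number of examples that Algorithm R1 draws: in each round `|S^(r)|` from the mixture and
`|T_i|` from every player `i`. -/
noncomputable def samplesR1 (C c : ℝ) (d k : ℕ) (ε δ : ℝ) : ℕ :=
  ∑ _r : Fin (rounds k), (learnSize C d k ε δ + ∑ _i : Fin k, testSize c k ε δ)

end CollabPAC

namespace CollabPAC

/-! ### Products of functions of independent coordinates and the Chernoff bound -/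

/-! The algorithm is a multiplicative-weights argument. Put `α = ε/6` and `q = ⌈log₂ k⌉`, so that
there are `5q` rounds. Realizability passes to every mixture, so in each round the VC theorem gives
mixture error at most `α/16` outside probability `δ'`. By Chernoff bounds, outside another `δ'`,
every player with error above `α` fails its test and every player with error at most `α/2` passes.
Over all rounds the failure probability is at most `5q · 2δ' = 2δ/3` (`roundLaw_fails_le`,
`law_not_goodRun_le`).

On a good run a failing player has error at least `α/2`, so by Markov the failing players carry at
most 1/8 of the weight, and a round multiplies the total by at most 9/8 (`GoodRun.sum_weights_le`).
Since `(9/8)^5 ≤ 2` and `k ≤ 2^q`, the final total is at most `4^q`. A player that failed `j` tests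
has weight `2^j`, hence `j ≤ 2q`, and at least `3q` classifiers have error at most `α` for it. Where
the majority errs, at least `q/2` of these `3q` err, and Markov gives error at most `6α = ε`
(`err_maj_le`).

The VC theorem is proved by symmetrization with an exponential moment: a consistent learner earns a
factor 2 for each mistake on a ghost sample. The expected product is at least `(1+α)^m · Pr[err >
α]`, while swapping training and ghost examples at random bounds it by the growth function at `2m`
(`lintegral_pairWeight_le`). Only the learner's own output is integrated, so no supremum over the
class has to be measurable. -/

lemma lintegral_pi_prod_eq_pow {α : Type*} [MeasurableSpace α] (μ : Measure α)
    [IsProbabilityMeasure μ] {g : α → ℝ≥0∞} (hg : Measurable g) (n : ℕ) :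
    ∫⁻ S, ∏ j, g (S j) ∂(Measure.pi fun _ : Fin n => μ) = (∫⁻ x, g x ∂μ) ^ n := by
  have hind : ProbabilityTheory.iIndepFun (fun (j : Fin n) (S : Fin n → α) => g (S j))
      (Measure.pi fun _ : Fin n => μ) :=
    ProbabilityTheory.iIndepFun_pi (X := fun _ : Fin n => g) fun _ => hg.aemeasurable
  rw [ProbabilityTheory.lintegral_prod_eq_prod_lintegral_of_indepFun _ _ hind
    fun j => hg.comp (measurable_pi_apply j)]
  have h1 (j : Fin n) : ∫⁻ S, g (S j) ∂(Measure.pi fun _ : Fin n => μ) = ∫⁻ x, g x ∂μ :=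
    (measurePreserving_eval (fun _ : Fin n => μ) j).lintegral_comp hg
  simp [h1]

lemma lintegral_ite_ofReal {α : Type*} [MeasurableSpace α] (μ : Measure α)
    [IsProbabilityMeasure μ] {A : Set α} [DecidablePred (· ∈ A)] (hA : MeasurableSet A) {b : ℝ} (hb : 0 ≤ b) :
    ∫⁻ x, (if x ∈ A then ENNReal.ofReal b else 1) ∂μ = ENNReal.ofReal (1 + μ.real A * (b - 1)) := by
  have h1 : (fun x => if x ∈ A then ENNReal.ofReal b else 1) =
      fun x => A.indicator (fun _ => ENNReal.ofReal b) x + Aᶜ.indicator (fun _ => 1) x := by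
    funext x
    by_cases hx : x ∈ A <;> simp [hx]
  rw [h1, lintegral_add_left (measurable_const.indicator hA), lintegral_indicator_const hA,
    lintegral_indicator_const hA.compl, one_mul, ← ofReal_measureReal, ← ofReal_measureReal,
    ← ENNReal.ofReal_mul hb, ← ENNReal.ofReal_add (by positivity) (by positivity),
    probReal_compl_eq_one_sub hA]
  congr 1
  ring

open Classical in
/-- The Chernoff bound; `s` may have either sign. -/
lemma chernoff {α : Type*} [MeasurableSpace α] (μ : Measure α) [IsProbabilityMeasure μ] {A : Set α}
    (hA : MeasurableSet A) (n : ℕ) (s a : ℝ) :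
    (Measure.pi fun _ : Fin n => μ).real
      {S | s * a ≤ s * ((Finset.univ.filter fun j => S j ∈ A).card : ℝ)} ≤
    Real.exp (n * (μ.real A * (Real.exp s - 1)) - s * a) := by
  set P := Measure.pi fun _ : Fin n => μ
  have hg : Measurable fun x => if x ∈ A then ENNReal.ofReal (Real.exp s) else 1 :=
    Measurable.ite hA measurable_const measurable_const
  have hmul := mul_meas_ge_le_lintegral (μ := P) (f := fun S : Fin n → α =>
    ∏ j, if S j ∈ A then ENNReal.ofReal (Real.exp s) else 1)
    (Finset.measurable_fun_prod _ fun j _ => hg.comp (measurable_pi_apply j))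
    (ENNReal.ofReal (Real.exp (s * a)))
  rw [lintegral_pi_prod_eq_pow μ hg, lintegral_ite_ofReal μ hA (Real.exp_pos s).le] at hmul
  have hset : {S : Fin n → α | s * a ≤ s * ((Finset.univ.filter fun j => S j ∈ A).card : ℝ)} ⊆
      {S | ENNReal.ofReal (Real.exp (s * a)) ≤
        ∏ j, if S j ∈ A then ENNReal.ofReal (Real.exp s) else 1} := by
    intro S hS
    simp only [Set.mem_ofPred_eq] at hS ⊢
    rw [Finset.prod_ite, Finset.prod_const_one, mul_one, Finset.prod_const,
      ← ENNReal.ofReal_pow (Real.exp_pos s).le, ← Real.exp_nat_mul]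
    exact ENNReal.ofReal_le_ofReal (Real.exp_le_exp.2 (by rwa [mul_comm _ s]))
  have hp : 0 ≤ 1 + μ.real A * (Real.exp s - 1) := by
    nlinarith [Real.exp_pos s, measureReal_nonneg (μ := μ) (s := A),
      measureReal_le_one (μ := μ) (s := A)]
  have h2 : ENNReal.ofReal (Real.exp (s * a)) *
      P {S | s * a ≤ s * ((Finset.univ.filter fun j => S j ∈ A).card : ℝ)} ≤
      ENNReal.ofReal ((1 + μ.real A * (Real.exp s - 1)) ^ n) := by
    rw [ENNReal.ofReal_pow hp]
    exact le_trans (mul_le_mul_right (measure_mono hset) _) hmul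
  rw [← ofReal_measureReal, ← ENNReal.ofReal_mul (Real.exp_pos _).le,
    ENNReal.ofReal_le_ofReal_iff (by positivity)] at h2
  have h3 : (1 + μ.real A * (Real.exp s - 1)) ^ n ≤
      Real.exp (n * (μ.real A * (Real.exp s - 1))) := by
    rw [Real.exp_nat_mul]
    exact pow_le_pow_left₀ hp (by linarith [Real.add_one_le_exp (μ.real A * (Real.exp s - 1))]) n
  rw [Real.exp_sub, le_div_iff₀ (Real.exp_pos _), mul_comm]
  exact h2.trans h3

/-! ### Numerical constants and tail bounds for the players' tests. -/

lemma log_four_thirds_le : Real.log (4 / 3) ≤ 7 / 24 := by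
  rw [Real.log_le_iff_le_exp (by norm_num)]
  have := Real.quadratic_le_exp_of_nonneg (x := 7 / 24) (by norm_num)
  linarith

lemma le_log_three_halves : 3 / 8 ≤ Real.log (3 / 2) := by
  rw [Real.le_log_iff_exp_le (by norm_num), show (3 / 8 : ℝ) = (4 : ℕ) * (3 / 32) by norm_num,
    Real.exp_nat_mul]
  have h1 : Real.exp (3 / 32) ≤ 32 / 29 := by
    have := Real.exp_bound_div_one_sub_of_interval (x := 3 / 32) (by norm_num) (by norm_num)
    norm_num at this ⊢
    linarith
  calc Real.exp (3 / 32) ^ 4 ≤ (32 / 29) ^ 4 := pow_le_pow_left₀ (Real.exp_pos _).le h1 4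
    _ ≤ 3 / 2 := by norm_num

lemma mul_empErr {X : Type*} {n : ℕ} (T : Fin n → Example X) (f : X → Bool) :
    n * empErr T f = ((Finset.univ.filter fun j => f (T j).1 ≠ (T j).2).card : ℝ) := by
  unfold empErr
  rcases Nat.eq_zero_or_pos n with rfl | hn
  · simp
  · field_simp

section Tests

variable {X : Type*} [MeasurableSpace X] (D : Measure (Example X)) [IsProbabilityMeasure D]
  {f : X → Bool}

/-- A classifier with error more than `α` is unlikely to pass a test with threshold `3 α / 4`. -/
lemma test_pass_le (hf : MeasurableSet {z : Example X | f z.1 ≠ z.2}) (n : ℕ) {α : ℝ} (hα : 0 < α)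
    (h : α < err D f) :
    (Measure.pi fun _ : Fin n => D).real {T | empErr T f ≤ 3 / 4 * α} ≤
      Real.exp (-(α * n / 32)) := by
  have hs : Real.exp (-Real.log (4 / 3)) = 3 / 4 := by
    rw [Real.exp_neg, Real.exp_log (by norm_num)]; norm_num
  have hc := chernoff D hf n (-Real.log (4 / 3)) (3 / 4 * α * n)
  have hlog : 0 < Real.log (4 / 3) := Real.log_pos (by norm_num)
  refine le_trans (measureReal_mono fun T hT => ?_) (hc.trans (Real.exp_le_exp.2 ?_))
  · simp only [Set.mem_ofPred_eq] at hT ⊢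
    have h1 := mul_le_mul_of_nonneg_left hT (Nat.cast_nonneg (α := ℝ) n)
    rw [mul_empErr] at h1
    have h2 := mul_le_mul_of_nonneg_left h1 hlog.le
    simp only [ne_eq] at h2
    convert (show _ from by linarith : -(Real.log (4 / 3)) * (3 / 4 * α * n) ≤ -(Real.log (4 / 3)) *
      ((Finset.univ.filter fun j => ¬ f (T j).1 = (T j).2).card : ℝ)) using 3
  · rw [hs]
    have h0 : D.real {z : Example X | f z.1 ≠ z.2} = err D f := rfl
    rw [h0]
    have hn : (0 : ℝ) ≤ n := Nat.cast_nonneg n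
    -- Per unit of `α n` the exponent is at most `-1/4 + (3/4)(7/24) = -1/32`.
    nlinarith [mul_nonneg hn (sub_nonneg.2 h.le), log_four_thirds_le,
      mul_nonneg (mul_nonneg hα.le hn) (sub_nonneg.2 log_four_thirds_le)]

/-- A classifier with error at most `α / 2` is unlikely to fail a test with threshold `3 α / 4`. -/
lemma test_fail_le (hf : MeasurableSet {z : Example X | f z.1 ≠ z.2}) (n : ℕ) {α : ℝ} (hα : 0 < α)
    (h : err D f ≤ α / 2) :
    (Measure.pi fun _ : Fin n => D).real {T | ¬ empErr T f ≤ 3 / 4 * α} ≤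
      Real.exp (-(α * n / 32)) := by
  have hs : Real.exp (Real.log (3 / 2)) = 3 / 2 := Real.exp_log (by norm_num)
  have hc := chernoff D hf n (Real.log (3 / 2)) (3 / 4 * α * n)
  have hlog : 0 < Real.log (3 / 2) := Real.log_pos (by norm_num)
  refine le_trans (measureReal_mono fun T hT => ?_) (hc.trans (Real.exp_le_exp.2 ?_))
  · simp only [Set.mem_ofPred_eq, not_le] at hT ⊢
    have h1 := mul_le_mul_of_nonneg_left hT.le (Nat.cast_nonneg (α := ℝ) n)
    rw [mul_empErr] at h1
    have h2 := mul_le_mul_of_nonneg_left h1 hlog.le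
    simp only [ne_eq] at h2
    convert (show _ from by linarith : (Real.log (3 / 2)) * (3 / 4 * α * n) ≤ (Real.log (3 / 2)) *
      ((Finset.univ.filter fun j => ¬ f (T j).1 = (T j).2).card : ℝ)) using 3
  · rw [hs]
    have h0 : D.real {z : Example X | f z.1 ≠ z.2} = err D f := rfl
    rw [h0]
    have hn : (0 : ℝ) ≤ n := Nat.cast_nonneg n
    -- Per unit of `α n` the exponent is at most `1/4 - (3/4)(3/8) = -1/32`.
    nlinarith [mul_nonneg hn (sub_nonneg.2 h), le_log_three_halves,
      mul_nonneg (mul_nonneg hα.le hn) (sub_nonneg.2 le_log_three_halves)]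

end Tests

/-! ### The Sauer–Shelah bound -/

/-- For `i ≤ d` one has `x^d ≤ x^i`, so the binomial theorem bounds `x^d` times the sum by
`(1+x)^N`. The parameter `x` stays free so that the VC theorem can choose it proportional to the
error level. -/
lemma sum_choose_le {N d : ℕ} {x : ℝ} (hx : 0 < x) (hx1 : x ≤ 1) :
    ((∑ i ∈ Finset.range (d + 1), N.choose i : ℕ) : ℝ) ≤ (1 / x) ^ d * Real.exp (x * N) := by
  have h1 : (∑ i ∈ Finset.range (d + 1), (N.choose i : ℝ)) * x ^ d ≤ (x + 1) ^ N := by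
    rw [add_pow, Finset.sum_mul]
    simp only [one_pow, mul_one]
    calc ∑ i ∈ Finset.range (d + 1), (N.choose i : ℝ) * x ^ d
        ≤ ∑ i ∈ Finset.range (d + 1), x ^ i * (N.choose i : ℝ) := by
          refine Finset.sum_le_sum fun i hi => ?_
          rw [mul_comm]
          exact mul_le_mul_of_nonneg_right (pow_le_pow_of_le_one hx.le hx1
            (Nat.lt_succ_iff.1 (Finset.mem_range.1 hi))) (Nat.cast_nonneg _)
      _ ≤ ∑ i ∈ Finset.range (max d N + 1), x ^ i * (N.choose i : ℝ) := by
          refine Finset.sum_le_sum_of_subset_of_nonneg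
            (Finset.range_mono (by omega)) fun i _ _ => by positivity
      _ = ∑ i ∈ Finset.range (N + 1), x ^ i * (N.choose i : ℝ) := by
          symm
          refine Finset.sum_subset (Finset.range_mono (by omega)) fun i _ hi => ?_
          rw [Nat.choose_eq_zero_of_lt (by simpa using hi)]
          simp
  have h2 : (x + 1) ^ N ≤ Real.exp (x * N) := by
    rw [mul_comm, Real.exp_nat_mul]
    exact pow_le_pow_left₀ (by positivity) (Real.add_one_le_exp x) N
  rw [div_pow, one_pow, one_div, inv_mul_eq_div, le_div_iff₀ (by positivity)]
  push_cast
  exact h1.trans h2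

/-- On a finite set of `N` points, a class of VC dimension `d` is represented by at most
`∑ i ≤ d, N.choose i` functions. -/
lemma exists_finset_representatives {X : Type*} {F : Set (X → Bool)} {d : ℕ} (hd : vcDim F = d)
    (A : Finset X) :
    ∃ R : Finset (X → Bool), R.card ≤ ∑ i ∈ Finset.range (d + 1), A.card.choose i ∧
      ∀ f ∈ F, ∃ g ∈ R, ∀ x ∈ A, f x = g x := by
  classical
  -- The traces of the class on `A`. A set shattered by this family is shattered by `F`, so it has
  -- at most `d` points, and a family has no more members than sets it shatters.
  let 𝒜 : Finset (Finset X) := A.powerset.filter fun B => ∃ f ∈ F, A.filter (fun x => f x) = B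
  refine ⟨𝒜.image fun B x => decide (x ∈ B), ?_, ?_⟩
  · have hsub : 𝒜.shatterer ⊆ (Finset.range (d + 1)).biUnion fun i => A.powersetCard i := by
      intro B hB
      rw [Finset.mem_shatterer] at hB
      obtain ⟨t, ht, hBt⟩ := hB.exists_superset
      have hBA : B ⊆ A := hBt.trans (Finset.mem_powerset.1 (Finset.mem_filter.1 ht).1)
      have hF : Shatters F B := by
        intro g
        obtain ⟨u, hu, hBu⟩ := hB (Finset.filter_subset (fun x => g x = true) B)
        obtain ⟨-, f, hf, rfl⟩ := Finset.mem_filter.1 hu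
        refine ⟨f, hf, fun x hx => ?_⟩
        have := Finset.ext_iff.1 hBu x
        simp only [Finset.mem_inter, Finset.mem_filter, hx, hBA hx, true_and] at this
        exact Bool.eq_iff_iff.2 this
      have hcard : (B.card : ℕ∞) ≤ d := by
        rw [← hd]
        exact le_iSup₂ (f := fun (A : Finset X) (_ : Shatters F A) => (A.card : ℕ∞)) B hF
      have hcard' : B.card ≤ d := by exact_mod_cast hcard
      simp only [Finset.mem_biUnion, Finset.mem_range, Finset.mem_powersetCard]
      exact ⟨B.card, by omega, hBA, rfl⟩
    calc _ ≤ 𝒜.card := Finset.card_image_le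
      _ ≤ 𝒜.shatterer.card := 𝒜.card_le_card_shatterer
      _ ≤ _ := Finset.card_le_card hsub
      _ ≤ ∑ i ∈ Finset.range (d + 1), (A.powersetCard i).card := Finset.card_biUnion_le
      _ = _ := by simp [Finset.card_powersetCard]
  · intro f hf
    refine ⟨fun x => decide (x ∈ A.filter fun x => f x), Finset.mem_image.2 ⟨_, ?_, rfl⟩, ?_⟩
    · exact Finset.mem_filter.2 ⟨Finset.mem_powerset.2 (Finset.filter_subset _ _), f, hf, rfl⟩
    · intro x hx
      simp [hx]

/-! ### The VC theorem for empirical risk minimizers -/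

/-- The weight that a classifier gets from a pair of examples, the first of them in the training
sample and the second in the ghost sample. -/
noncomputable def pairWeight {X : Type*} (f : X → Bool) (z : Example X × Example X) : ℝ≥0∞ :=
  if f z.1.1 = z.1.2 then (if f z.2.1 ≠ z.2.2 then ENNReal.ofReal 2 else 1) else 0

/-- No mistake in the pair gives 1 + 1, exactly one gives 2 + 0, two give 0. Thus a uniformly random
order of the pair has mean weight at most 1, and 2 is the largest reward with this property. -/
lemma pairWeight_add_swap_le {X : Type*} (f : X → Bool) (z : Example X × Example X) :
    pairWeight f z + pairWeight f z.swap ≤ 2 := by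
  unfold pairWeight
  by_cases h1 : f z.1.1 = z.1.2 <;> by_cases h2 : f z.2.1 = z.2.2 <;> simp [h1, h2]
  norm_num

/-- Swap the pairs selected by `σ`. -/
def swapPairs {E : Type*} {m : ℕ} (σ : Fin m → Bool) (z : Fin m → E × E) : Fin m → E × E :=
  fun j => if σ j then (z j).swap else z j

lemma measurePreserving_swapPairs {E : Type*} [MeasurableSpace E] (D : Measure E)
    [IsProbabilityMeasure D] {m : ℕ} (σ : Fin m → Bool) :
    MeasurePreserving (swapPairs (E := E) σ) (Measure.pi fun _ => D.prod D)
      (Measure.pi fun _ => D.prod D) := by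
  refine measurePreserving_pi (fun _ => D.prod D) (fun _ => D.prod D)
    (f := fun j w => if σ j then w.swap else w) fun j => ?_
  cases σ j
  · simpa using! MeasurePreserving.id (D.prod D)
  · simpa using Measure.measurePreserving_swap

lemma sum_prod_pairWeight_le {X : Type*} {m : ℕ} (f : X → Bool)
    (z : Fin m → Example X × Example X) :
    ∑ σ : Fin m → Bool, ∏ j, pairWeight f (swapPairs σ z j) ≤ 2 ^ m := by
  have h := Finset.prod_univ_sum (fun _ : Fin m => (Finset.univ : Finset Bool))
    fun j b => pairWeight f (if b then (z j).swap else z j)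
  rw [Fintype.piFinset_univ] at h
  unfold swapPairs
  rw [← h]
  refine (Finset.prod_le_pow_card _ _ 2 fun j _ => ?_).trans (by simp)
  simpa [add_comm] using pairWeight_add_swap_le f (z j)

section

variable {X : Type*} [MeasurableSpace X] {F : Set (X → Bool)} {O : Learner X}

lemma measurable_pairWeight_learner (hO : IsERM F O) {m : ℕ} :
    Measurable fun z : Fin m → Example X × Example X =>
      ∏ j, pairWeight (O m fun i => (z i).1) (z j) := by
  refine Finset.measurable_fun_prod _ fun j _ => ?_
  have hS : Measurable fun z : Fin m → Example X × Example X => fun i => (z i).1 :=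
    measurable_pi_lambda _ fun i => (measurable_pi_apply i).fst
  have h1 : Measurable fun z : Fin m → Example X × Example X => O m (fun i => (z i).1) (z j).1.1 :=
    (hO.measurable m).comp (hS.prodMk (measurable_pi_apply j).fst.fst)
  have h2 : Measurable fun z : Fin m → Example X × Example X => O m (fun i => (z i).1) (z j).2.1 :=
    (hO.measurable m).comp (hS.prodMk (measurable_pi_apply j).snd.fst)
  exact (measurable_of_countable (fun b : (Bool × Bool) × (Bool × Bool) =>
    (if b.1.1 = b.1.2 then (if b.2.1 ≠ b.2.2 then ENNReal.ofReal 2 else 1) else 0 : ℝ≥0∞))).comp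
    ((h1.prodMk (measurable_pi_apply j).fst.snd).prodMk
      (h2.prodMk (measurable_pi_apply j).snd.snd))

/-- Swapping within pairs preserves the law, so the integrand may be averaged over all `2^m` swaps.
With the points fixed, every classifier learned from a swapped sample agrees on them with one of the
Sauer–Shelah representatives, and each representative averages to at most 1. -/
lemma lintegral_pairWeight_le (hO : IsERM F O) {d : ℕ} (hd : vcDim F = d)
    (D : Measure (Example X)) [IsProbabilityMeasure D] (m : ℕ) :
    ∫⁻ z, ∏ j, pairWeight (O m fun i => (z i).1) (z j) ∂(Measure.pi fun _ : Fin m => D.prod D) ≤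
      (∑ i ∈ Finset.range (d + 1), (2 * m).choose i : ℕ) := by
  classical
  set P := Measure.pi fun _ : Fin m => D.prod D
  set G : (Fin m → Example X × Example X) → ℝ≥0∞ := fun z =>
    ∏ j, pairWeight (O m fun i => (z i).1) (z j)
  have hG : Measurable G := measurable_pairWeight_learner hO
  have hswap (σ : Fin m → Bool) : ∫⁻ z, G (swapPairs σ z) ∂P = ∫⁻ z, G z ∂P :=
    (measurePreserving_swapPairs D σ).lintegral_comp hG
  have hpt (z : Fin m → Example X × Example X) : ∑ σ : Fin m → Bool, G (swapPairs σ z) ≤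
      (∑ i ∈ Finset.range (d + 1), (2 * m).choose i : ℕ) * 2 ^ m := by
    let A : Finset X := Finset.univ.image (fun j => (z j).1.1) ∪ Finset.univ.image fun j => (z j).2.1
    have hA : A.card ≤ 2 * m := by
      refine (Finset.card_union_le _ _).trans ?_
      have h1 := Finset.card_image_le (s := Finset.univ) (f := fun j => (z j).1.1)
      have h2 := Finset.card_image_le (s := Finset.univ) (f := fun j => (z j).2.1)
      simp only [Finset.card_univ, Fintype.card_fin] at h1 h2
      omega
    have hA1 (j) : (z j).1.1 ∈ A :=
      Finset.mem_union_left _ (Finset.mem_image_of_mem (fun j => (z j).1.1) (Finset.mem_univ j))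
    have hA2 (j) : (z j).2.1 ∈ A :=
      Finset.mem_union_right _ (Finset.mem_image_of_mem (fun j => (z j).2.1) (Finset.mem_univ j))
    obtain ⟨R, hR, hRF⟩ := exists_finset_representatives hd A
    calc ∑ σ : Fin m → Bool, G (swapPairs σ z)
        ≤ ∑ σ : Fin m → Bool, ∑ g ∈ R, ∏ j, pairWeight g (swapPairs σ z j) := by
          refine Finset.sum_le_sum fun σ _ => ?_
          -- The learned classifier changes with `σ`, and so does its representative; summing over
          -- all of `R` removes this dependence, as the underlying points do not change.
          obtain ⟨g, hg, hfg⟩ := hRF _ (hO.mem m fun i => (swapPairs σ z i).1)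
          have : G (swapPairs σ z) = ∏ j, pairWeight g (swapPairs σ z j) := by
            refine Finset.prod_congr rfl fun j _ => ?_
            unfold pairWeight
            have e1 : (swapPairs σ z j).1.1 ∈ A := by
              unfold swapPairs
              cases σ j <;> simp [hA1, hA2]
            have e2 : (swapPairs σ z j).2.1 ∈ A := by
              unfold swapPairs
              cases σ j <;> simp [hA1, hA2]
            rw [hfg _ e1, hfg _ e2]
          rw [this]
          exact Finset.single_le_sum (f := fun g => ∏ j, pairWeight g (swapPairs σ z j))
            (fun _ _ => zero_le) hg
      _ = ∑ g ∈ R, ∑ σ : Fin m → Bool, ∏ j, pairWeight g (swapPairs σ z j) := Finset.sum_comm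
      _ ≤ ∑ g ∈ R, 2 ^ m := Finset.sum_le_sum fun g _ => sum_prod_pairWeight_le g z
      _ = R.card * 2 ^ m := by simp
      _ ≤ _ := by
          refine mul_le_mul_left ?_ _
          exact_mod_cast hR.trans (Finset.sum_le_sum fun i _ => Nat.choose_le_choose i hA)
  have hsum : (2 : ℝ≥0∞) ^ m * ∫⁻ z, G z ∂P ≤
      2 ^ m * (∑ i ∈ Finset.range (d + 1), (2 * m).choose i : ℕ) := by
    calc (2 : ℝ≥0∞) ^ m * ∫⁻ z, G z ∂P = ∑ σ : Fin m → Bool, ∫⁻ z, G (swapPairs σ z) ∂P := by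
          simp [hswap]
      _ = ∫⁻ z, ∑ σ : Fin m → Bool, G (swapPairs σ z) ∂P :=
          (lintegral_finsetSum _ fun σ _ =>
            hG.comp (measurePreserving_swapPairs D σ).measurable).symm
      _ ≤ ∫⁻ _, (∑ i ∈ Finset.range (d + 1), (2 * m).choose i : ℕ) * 2 ^ m ∂P :=
          lintegral_mono hpt
      _ = _ := by simp [mul_comm]
  exact (ENNReal.mul_le_mul_iff_right (by simp) (by simp)).1 hsum

lemma measurableSet_learner_ne (hO : IsERM F O) {m : ℕ} :
    MeasurableSet {p : (Fin m → Example X) × Example X | O m p.1 p.2.1 ≠ p.2.2} := by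
  have h1 : Measurable fun p : (Fin m → Example X) × Example X => O m p.1 p.2.1 :=
    (hO.measurable m).comp (measurable_fst.prodMk measurable_snd.fst)
  exact (measurableSet_eq_fun h1 measurable_snd.snd).compl

lemma measurable_err_learner (hO : IsERM F O) (D : Measure (Example X)) [IsProbabilityMeasure D]
    {m : ℕ} : Measurable fun S : Fin m → Example X => err D (O m S) :=
  (measurable_measure_prodMk_left (ν := D) (measurableSet_learner_ne hO)).ennreal_toReal

lemma learner_consistent (hO : IsERM F O) {D : Measure (Example X)} [IsProbabilityMeasure D]
    {f : X → Bool} (hf : f ∈ F) (hfD : err D f = 0) (m : ℕ) :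
    ∀ᵐ S ∂(Measure.pi fun _ : Fin m => D), ∀ j, O m S (S j).1 = (S j).2 := by
  have h0 : ∀ᵐ z ∂D, f z.1 = z.2 := by
    rw [ae_iff]
    exact (measureReal_eq_zero_iff).1 hfD
  have h1 : ∀ᵐ S ∂(Measure.pi fun _ : Fin m => D), ∀ j, f (S j).1 = (S j).2 :=
    ae_all_iff.2 fun j => (measurePreserving_eval (fun _ : Fin m => D) j).quasiMeasurePreserving.ae h0
  filter_upwards [h1] with S hS j
  have hle := hO.le m S f hf
  have hz : empErr S f = 0 := by simp [empErr, hS]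
  have hm : (0 : ℝ) ≤ m := Nat.cast_nonneg m
  have h2 : m * empErr S (O m S) ≤ 0 := by nlinarith
  rw [mul_empErr] at h2
  have h3 : (Finset.univ.filter fun j => O m S (S j).1 ≠ (S j).2).card = 0 := by
    exact_mod_cast le_antisymm h2 (Nat.cast_nonneg _)
  rw [Finset.card_eq_zero, Finset.filter_eq_empty_iff] at h3
  simpa using h3 (Finset.mem_univ j)

/-- Almost surely the learner is consistent with `S`; the ghost sample then integrates, by
independence, to exactly `(1 + err)^m`. On the event in question this exceeds `(1+α)^m`. -/
lemma mul_learner_err_gt_le (hO : IsERM F O) {d : ℕ} (hd : vcDim F = d)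
    (D : Measure (Example X)) [IsProbabilityMeasure D] {f : X → Bool} (hf : f ∈ F)
    (hfD : err D f = 0) (m : ℕ) {α : ℝ} (hα : 0 < α) :
    (1 + α) ^ m * (Measure.pi fun _ : Fin m => D).real {S | α < err D (O m S)} ≤
      (∑ i ∈ Finset.range (d + 1), (2 * m).choose i : ℕ) := by
  classical
  set μ := Measure.pi fun _ : Fin m => D
  have hmeas : MeasurableSet {S : Fin m → Example X | α < err D (O m S)} :=
    measurableSet_lt measurable_const (measurable_err_learner hO D)
  have hI := lintegral_pairWeight_le hO hd D m
  have hmp := measurePreserving_arrowProdEquivProdArrow (Example X) (Example X) (Fin m)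
    (fun _ => D) (fun _ => D)
  have hW : Measurable fun p : (Fin m → Example X) × (Fin m → Example X) =>
      ∏ j, pairWeight (O m p.1) (p.1 j, p.2 j) := by
    have := (measurable_pairWeight_learner (m := m) hO).comp
      (MeasurableEquiv.arrowProdEquivProdArrow (Example X) (Example X) (Fin m)).symm.measurable
    exact this
  have hI2 : ∫⁻ z, ∏ j, pairWeight (O m fun i => (z i).1) (z j)
      ∂(Measure.pi fun _ : Fin m => D.prod D) =
      ∫⁻ S, ∫⁻ T, ∏ j, pairWeight (O m S) (S j, T j) ∂μ ∂μ := by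
    rw [← lintegral_prod _ hW.aemeasurable, ← hmp.lintegral_comp hW]
    rfl
  have hinner : ∀ᵐ S ∂μ, {S | α < err D (O m S)}.indicator
      (fun _ => ENNReal.ofReal ((1 + α) ^ m)) S ≤
      ∫⁻ T, ∏ j, pairWeight (O m S) (S j, T j) ∂μ := by
    filter_upwards [learner_consistent hO hf hfD m] with S hS
    have hA : MeasurableSet {z : Example X | O m S z.1 ≠ z.2} :=
      measurable_prodMk_left (measurableSet_learner_ne hO)
    have e1 : ∫⁻ T, ∏ j, pairWeight (O m S) (S j, T j) ∂μ =
        ENNReal.ofReal (1 + err D (O m S)) ^ m := by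
      have e2 := lintegral_pi_prod_eq_pow D (g := fun z : Example X =>
        if z ∈ {z : Example X | O m S z.1 ≠ z.2} then ENNReal.ofReal 2 else 1)
        (Measurable.ite hA measurable_const measurable_const) m
      rw [lintegral_ite_ofReal D hA (by norm_num)] at e2
      have e3 : D.real {z : Example X | O m S z.1 ≠ z.2} = err D (O m S) := rfl
      rw [e3] at e2
      norm_num at e2
      rw [← e2]
      refine lintegral_congr fun T => Finset.prod_congr rfl fun j _ => ?_
      simp [pairWeight, hS]
    rw [e1]
    by_cases hSα : α < err D (O m S)
    · rw [Set.indicator_of_mem (by exact hSα), ENNReal.ofReal_pow (by positivity)]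
      gcongr
    · rw [Set.indicator_of_notMem (by exact hSα)]
      exact zero_le
  have hlow := lintegral_mono_ae hinner
  rw [lintegral_indicator_const hmeas, ← hI2] at hlow
  have hfin := hlow.trans hI
  rw [← ofReal_measureReal, ← ENNReal.ofReal_mul (by positivity), ← ENNReal.ofReal_natCast,
    ENNReal.ofReal_le_ofReal_iff (Nat.cast_nonneg _)] at hfin
  exact hfin

/-- The VC theorem in the realizable case. -/
lemma learner_err_gt_le (hO : IsERM F O) {d : ℕ} (hd : vcDim F = d)
    (D : Measure (Example X)) [IsProbabilityMeasure D] {f : X → Bool} (hf : f ∈ F)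
    (hfD : err D f = 0) {C α β : ℝ} (hC : 8 ≤ C) (hα : 0 < α) (hα8 : α ≤ 1 / 8) (hβ : 0 < β)
    (hβ1 : β ≤ 1) :
    (Measure.pi fun _ : Fin (vcSize C d α β) => D).real
      {S | α < err D (O (vcSize C d α β) S)} ≤ β := by
  set m := vcSize C d α β with hm
  have hmain := mul_learner_err_gt_le hO hd D hf hfD m hα
  set p := (Measure.pi fun _ : Fin m => D).real {S | α < err D (O m S)}
  have hp : 0 ≤ p := measureReal_nonneg
  -- With `x = α/8` the growth function costs `exp(αm/4)`, half of the gain `exp(αm/2)` in `h1`.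
  -- Since `C ≥ 8`, the other half covers `2d log(1/α) + 2 log(1/β)`, and `log(8/α) ≤ 2 log(1/α)`
  -- because `α ≤ 1/8`.
  have hgrow := sum_choose_le (N := 2 * m) (d := d) (x := α / 8) (by positivity) (by linarith)
  have h1 : Real.exp (α / 2 * m) ≤ (1 + α) ^ m := by
    rw [mul_comm, Real.exp_nat_mul]
    refine pow_le_pow_left₀ (Real.exp_pos _).le ?_ m
    have := Real.exp_bound_div_one_sub_of_interval (x := α / 2) (by positivity) (by linarith)
    refine this.trans ?_
    rw [div_le_iff₀ (by linarith)]
    nlinarith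
  have hla : Real.log (1 / (α / 8)) ≤ 2 * Real.log (1 / α) := by
    rw [show 2 * Real.log (1 / α) = Real.log ((1 / α) ^ 2) by rw [Real.log_pow]; norm_num]
    refine Real.log_le_log (by positivity) ?_
    rw [one_div_div, div_pow, one_pow, div_le_div_iff₀ hα (by positivity)]
    nlinarith
  have hL1 : 0 ≤ Real.log (1 / α) := Real.log_nonneg (by rw [le_div_iff₀ hα]; linarith)
  have hL2 : 0 ≤ Real.log (1 / β) := Real.log_nonneg (by rw [le_div_iff₀ hβ]; linarith)
  have hm1 : C / α * (d * Real.log (1 / α) + Real.log (1 / β)) ≤ m := Nat.le_ceil _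
  have hd0 : (0 : ℝ) ≤ d := Nat.cast_nonneg d
  have hm2 : 8 * (d * Real.log (1 / α) + Real.log (1 / β)) ≤ α * m := by
    have h2 : C * (d * Real.log (1 / α) + Real.log (1 / β)) ≤ α * m := by
      rw [div_mul_eq_mul_div, div_le_iff₀ hα] at hm1
      linarith
    nlinarith [mul_nonneg hd0 hL1]
  have hpow : (1 / (α / 8)) ^ d = Real.exp (d * Real.log (1 / (α / 8))) := by
    rw [Real.exp_nat_mul, Real.exp_log (by positivity)]
  have hβe : β = Real.exp (-Real.log (1 / β)) := by
    rw [one_div, Real.log_inv, neg_neg, Real.exp_log hβ]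
  have h3 : Real.exp (α / 2 * m) * p ≤
      Real.exp (d * Real.log (1 / (α / 8)) + α / 8 * (2 * m : ℕ)) := by
    rw [Real.exp_add, ← hpow]
    exact (mul_le_mul_of_nonneg_right h1 hp).trans (hmain.trans hgrow)
  rw [← le_div_iff₀' (Real.exp_pos _), ← Real.exp_sub] at h3
  refine h3.trans ?_
  refine le_trans (Real.exp_le_exp.2 ?_) hβe.ge
  push_cast
  nlinarith [mul_le_mul_of_nonneg_left hla hd0]

end

-- Turns a bound on the total weight into a bound on the number of failed tests.
open Classical in
lemma weights_eq_pow {X : Type*} {k : ℕ} {O : Learner X} {m n r : ℕ} {α : ℝ} (h : Fin r → RoundData X k m n) (i : Fin k) :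
    weights O α r h i = 2 ^ (Finset.univ.filter fun s => i ∉ passed O α (h s)).card := by
  simp only [Finset.card_filter]
  induction r with
  | zero => simp [weights]
  | succ r ih =>
    rw [Fin.sum_univ_castSucc, weights]
    by_cases hi : i ∈ passed O α (h (Fin.last r)) <;> simp [hi, ih, pow_succ, mul_comm]

section Execution

variable {X : Type*} [MeasurableSpace X] {k : ℕ} (D : Fin k → Measure (Example X))
  {F : Set (X → Bool)} {O : Learner X}

/-! ### A single round -/

/-- A round fails if the learned classifier has weighted error above `α / 16`, if a player with
error above `α` passes the test, or if a player with error at most `α / 2` does not. -/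
def RoundFails {m n : ℕ} (O : Learner X) (α : ℝ) (w : Fin k → ℝ≥0) (ρ : RoundData X k m n) : Prop :=
  α / 16 * ∑ i, (w i : ℝ) < ∑ i, (w i : ℝ) * err (D i) (roundClassifier O ρ) ∨
    ∃ i, (α < err (D i) (roundClassifier O ρ) ∧ i ∈ passed O α ρ) ∨
      (err (D i) (roundClassifier O ρ) ≤ α / 2 ∧ i ∉ passed O α ρ)

lemma measurableSet_classifier_ne (hO : IsERM F O) {m : ℕ} (S : Fin m → Example X) :
    MeasurableSet {z : Example X | O m S z.1 ≠ z.2} :=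
  measurable_prodMk_left (measurableSet_learner_ne hO)

variable [∀ i, IsProbabilityMeasure (D i)]

/-- Reads the weighted average of the players' errors as one error, to which the VC theorem applies.
For total weight zero both sides vanish. -/
lemma err_mixture (w : Fin k → ℝ≥0) (f : X → Bool) :
    (∑ i, (w i : ℝ))⁻¹ * ∑ i, (w i : ℝ) * err (D i) f = err (mixture D w) f := by
  have h (i : Fin k) : (w i • D i).real {z : Example X | f z.1 ≠ z.2} = w i * err (D i) f := by
    rw [measureReal_def, Measure.smul_apply, ENNReal.smul_def, smul_eq_mul, ENNReal.toReal_mul]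
    rfl
  unfold mixture
  rw [err, measureReal_def, Measure.smul_apply, ENNReal.smul_def, smul_eq_mul, ENNReal.toReal_mul,
    Measure.coe_finsetSum, Finset.sum_apply, ENNReal.toReal_sum]
  · simp only [← measureReal_def, h]
    simp
  · intro i _
    exact measure_ne_top _ _

lemma measurable_err_roundClassifier (hO : IsERM F O) {m n : ℕ} (i : Fin k) :
    Measurable fun ρ : RoundData X k m n => err (D i) (roundClassifier O ρ) :=
  (measurable_err_learner hO (D i)).comp measurable_fst

lemma measurableSet_roundFails (hO : IsERM F O) {m n : ℕ} (α : ℝ) :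
    MeasurableSet {p : (Fin k → ℝ≥0) × RoundData X k m n | RoundFails D O α p.1 p.2} := by
  have he (i : Fin k) : Measurable fun p : (Fin k → ℝ≥0) × RoundData X k m n =>
      err (D i) (roundClassifier O p.2) := (measurable_err_roundClassifier D hO i).comp measurable_snd
  have hw (i : Fin k) : Measurable fun p : (Fin k → ℝ≥0) × RoundData X k m n => (p.1 i : ℝ) :=
    measurable_coe_nnreal_real.comp ((measurable_pi_apply i).comp measurable_fst)
  have hp (i : Fin k) : MeasurableSet {p : (Fin k → ℝ≥0) × RoundData X k m n |
      i ∈ passed O α p.2} := (measurable_passed hO α i).preimage measurable_snd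
  have h1 : MeasurableSet {p : (Fin k → ℝ≥0) × RoundData X k m n |
      α / 16 * ∑ i, (p.1 i : ℝ) < ∑ i, (p.1 i : ℝ) * err (D i) (roundClassifier O p.2)} :=
    measurableSet_lt ((Finset.measurable_fun_sum _ fun i _ => hw i).const_mul _)
      (Finset.measurable_fun_sum _ fun i _ => (hw i).mul (he i))
  have h2 (i : Fin k) : MeasurableSet {p : (Fin k → ℝ≥0) × RoundData X k m n |
      (α < err (D i) (roundClassifier O p.2) ∧ i ∈ passed O α p.2) ∨
        (err (D i) (roundClassifier O p.2) ≤ α / 2 ∧ i ∉ passed O α p.2)} :=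
    ((measurableSet_lt measurable_const (he i)).inter (hp i)).union
      ((measurableSet_le (he i) measurable_const).inter (hp i).compl)
  convert h1.union (MeasurableSet.iUnion h2) using 1
  ext p
  simp [RoundFails]

/-- With `S` fixed the classifier is fixed too, and the fresh test sample is independent of it. At
most one of the two alternatives is possible, and between `α/2` and `α` either test result is
acceptable. -/
lemma pi_test_fails_le (hO : IsERM F O) {m n : ℕ} {α : ℝ} (hα : 0 < α) (i : Fin k)
    (S : Fin m → Example X) :
    (Measure.pi fun i : Fin k => Measure.pi fun _ : Fin n => D i)
      {T | (α < err (D i) (O m S) ∧ empErr (T i) (O m S) ≤ 3 / 4 * α) ∨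
        (err (D i) (O m S) ≤ α / 2 ∧ ¬ empErr (T i) (O m S) ≤ 3 / 4 * α)} ≤
      ENNReal.ofReal (Real.exp (-(α * n / 32))) := by
  set B : Set (Fin n → Example X) :=
    {T | (α < err (D i) (O m S) ∧ empErr T (O m S) ≤ 3 / 4 * α) ∨
      (err (D i) (O m S) ≤ α / 2 ∧ ¬ empErr T (O m S) ≤ 3 / 4 * α)} with hB
  have hemp : Measurable fun T : Fin n → Example X => empErr T (O m S) :=
    measurable_empErr (fun T => T) measurable_id (fun _ => O m S)
      ((hO.measurable m).comp (measurable_const.prodMk measurable_snd))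
  have hle : MeasurableSet {T : Fin n → Example X | empErr T (O m S) ≤ 3 / 4 * α} :=
    measurableSet_le hemp measurable_const
  have hBm : MeasurableSet B :=
    (MeasurableSet.inter (MeasurableSet.const _) hle).union
      (MeasurableSet.inter (MeasurableSet.const _) hle.compl)
  have hmp := measurePreserving_eval (fun i : Fin k => Measure.pi fun _ : Fin n => D i) i
  refine (hmp.measure_preimage hBm.nullMeasurableSet).le.trans ?_
  rw [← ofReal_measureReal]
  refine ENNReal.ofReal_le_ofReal ?_
  by_cases h1 : α < err (D i) (O m S)
  · refine (measureReal_mono fun T hT => ?_).trans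
      (test_pass_le (D i) (measurableSet_classifier_ne hO S) n hα h1)
    rcases hT with hT | hT
    · exact hT.2
    · linarith [hT.1]
  by_cases h2 : err (D i) (O m S) ≤ α / 2
  · refine (measureReal_mono fun T hT => ?_).trans
      (test_fail_le (D i) (measurableSet_classifier_ne hO S) n hα h2)
    rcases hT with hT | hT
    · exact absurd hT.1 h1
    · exact hT.2
  · have : B = ∅ := by
      ext T
      simp [hB, h1, h2]
    rw [this]
    simpa using (Real.exp_pos _).le

/-- A union bound: `β` for learning from the mixture, one exponential for each player's test. It is
uniform in `w`, so it holds conditionally on any history. -/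
lemma roundLaw_fails_le (hO : IsERM F O) {d : ℕ} (hd : vcDim F = d) {f : X → Bool} (hf : f ∈ F)
    (hfD : ∀ i, err (D i) f = 0) {C α β : ℝ} (hC : 8 ≤ C) (hα : 0 < α) (hα1 : α ≤ 1) (hβ : 0 < β)
    (hβ1 : β ≤ 1) (n : ℕ) (w : Fin k → ℝ≥0) (hw : ∑ i, w i ≠ 0) :
    roundLaw D (vcSize C d (α / 16) β) n w {ρ | RoundFails D O α w ρ} ≤
      ENNReal.ofReal (β + k * Real.exp (-(α * n / 32))) := by
  have := isProbabilityMeasure_mixture D w hw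
  set m := vcSize C d (α / 16) β with hm
  have hw' : 0 < ∑ i, (w i : ℝ) := by
    have : (0 : ℝ≥0) < ∑ i, w i := pos_iff_ne_zero.2 hw
    exact_mod_cast this
  set A : Set (Fin m → Example X) := {S | α / 16 < err (mixture D w) (O m S)} with hA
  let B : Fin k → Set (RoundData X k m n) := fun i =>
    {ρ | (α < err (D i) (roundClassifier O ρ) ∧ i ∈ passed O α ρ) ∨
      (err (D i) (roundClassifier O ρ) ≤ α / 2 ∧ i ∉ passed O α ρ)}
  have hsub : {ρ : RoundData X k m n | RoundFails D O α w ρ} ⊆ Prod.fst ⁻¹' A ∪ ⋃ i, B i := by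
    rintro ρ (h | ⟨i, hi⟩)
    · refine Or.inl ?_
      change α / 16 < err (mixture D w) (O m ρ.1)
      rw [← err_mixture, inv_mul_eq_div, lt_div_iff₀ hw']
      exact h
    · exact Or.inr (Set.mem_iUnion.2 ⟨i, hi⟩)
  have hAm : MeasurableSet A :=
    measurableSet_lt measurable_const (measurable_err_learner hO (mixture D w))
  have hA1 : roundLaw D m n w (Prod.fst ⁻¹' A) ≤ ENNReal.ofReal β := by
    have hmp : MeasurePreserving Prod.fst (roundLaw D m n w)
        (Measure.pi fun _ : Fin m => mixture D w) := measurePreserving_fst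
    rw [hmp.measure_preimage hAm.nullMeasurableSet, ← ofReal_measureReal]
    refine ENNReal.ofReal_le_ofReal (learner_err_gt_le hO hd (mixture D w) hf ?_ hC (by positivity)
      (by linarith) hβ hβ1)
    rw [← err_mixture]
    simp [hfD]
  have hB1 (i : Fin k) : roundLaw D m n w (B i) ≤ ENNReal.ofReal (Real.exp (-(α * n / 32))) := by
    have he := measurable_err_roundClassifier (m := m) (n := n) D hO i
    have hp := measurable_passed (m := m) (n := n) hO α i
    have hBm : MeasurableSet (B i) :=
      ((measurableSet_lt measurable_const he).inter hp).union
        ((measurableSet_le he measurable_const).inter hp.compl)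
    unfold roundLaw
    rw [Measure.prod_apply hBm]
    refine (lintegral_mono fun S => pi_test_fails_le D hO hα i S).trans ?_
    simp
  calc _ ≤ roundLaw D m n w (Prod.fst ⁻¹' A ∪ ⋃ i, B i) := measure_mono hsub
    _ ≤ roundLaw D m n w (Prod.fst ⁻¹' A) + ∑ i, roundLaw D m n w (B i) :=
        (measure_union_le _ _).trans (add_le_add_right (measure_iUnion_fintype_le _ _) _)
    _ ≤ ENNReal.ofReal β + ∑ _i : Fin k, ENNReal.ofReal (Real.exp (-(α * n / 32))) :=
        add_le_add hA1 (Finset.sum_le_sum fun i _ => hB1 i)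
    _ = _ := by
        rw [ENNReal.ofReal_add hβ.le (by positivity), ENNReal.ofReal_mul (by positivity)]
        simp

/-! ### The whole run -/

/-- No round of the run fails. -/
def GoodRun {m n : ℕ} (O : Learner X) (α : ℝ) : (r : ℕ) → (Fin r → RoundData X k m n) → Prop
  | 0, _ => True
  | r + 1, h => GoodRun O α r (fun s => h s.castSucc) ∧
      ¬ RoundFails D O α (weights O α r fun s => h s.castSucc) (h (Fin.last r))

lemma measurable_weights (hO : IsERM F O) {m n : ℕ} (α : ℝ) (r : ℕ) :
    Measurable (weights (k := k) (m := m) (n := n) O α r) := by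
  obtain ⟨e, he, hw⟩ := exists_weights_eq (k := k) (m := m) (n := n) hO α r
  have : weights (k := k) (m := m) (n := n) O α r = fun h i => 2 ^ e h i := funext hw
  rw [this]
  exact measurable_pi_lambda _ fun i =>
    (measurable_of_countable (fun a : ℕ => (2 : ℝ≥0) ^ a)).comp ((measurable_pi_apply i).comp he)

lemma sum_weights_ne_zero (hk : k ≠ 0) (hO : IsERM F O) {m n : ℕ} (α : ℝ) (r : ℕ)
    (h : Fin r → RoundData X k m n) : ∑ i, weights O α r h i ≠ 0 := by
  obtain ⟨e, -, hw⟩ := exists_weights_eq (k := k) (m := m) (n := n) hO α r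
  rw [hw]
  exact (Finset.sum_pos (fun i _ => by positivity)
    ⟨⟨0, Nat.pos_of_ne_zero hk⟩, Finset.mem_univ _⟩).ne'

lemma measurableSet_goodRun (hO : IsERM F O) {m n : ℕ} (α : ℝ) (r : ℕ) :
    MeasurableSet {h : Fin r → RoundData X k m n | GoodRun D O α r h} := by
  induction r with
  | zero => simp [GoodRun]
  | succ r ih =>
    have hinit : Measurable fun (h : Fin (r + 1) → RoundData X k m n) (s : Fin r) => h s.castSucc :=
      measurable_pi_lambda _ fun s => measurable_pi_apply s.castSucc
    exact (hinit ih).inter ((((measurable_weights hO α r).comp hinit).prodMk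
      (measurable_pi_apply (Fin.last r))) (measurableSet_roundFails D hO α)).compl

/-- A run is bad only if its prefix is bad or its last round fails; given any prefix, the latter has
probability at most `η`. -/
lemma law_not_goodRun_le (hk : k ≠ 0) (hO : IsERM F O) {m n : ℕ} {α : ℝ} {η : ℝ≥0∞}
    (hη : ∀ w : Fin k → ℝ≥0, ∑ i, w i ≠ 0 →
      roundLaw D m n w {ρ | RoundFails D O α w ρ} ≤ η) (r : ℕ) :
    law D O m n α r {h | ¬ GoodRun D O α r h} ≤ r * η := by
  induction r with
  | zero => simp [GoodRun]
  | succ r ih =>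
    have hm := (measurableSet_goodRun (m := m) (n := n) D hO α (r + 1)).compl
    have hm0 := (measurableSet_goodRun (m := m) (n := n) D hO α r).compl
    have hwd := law_wellDefined hk D hO m n α r
    have := hwd.2
    change (law D O m n α (r + 1)) {h | GoodRun D O α (r + 1) h}ᶜ ≤ _
    change (law D O m n α r) {h | GoodRun D O α r h}ᶜ ≤ _ at ih
    unfold law
    rw [Measure.bind_apply hm hwd.1.aemeasurable]
    have hpt (h : Fin r → RoundData X k m n) :
        ((roundLaw D m n (weights O α r h)).map
          fun ρ => Fin.snoc (α := fun _ => RoundData X k m n) h ρ)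
            {h | GoodRun D O α (r + 1) h}ᶜ ≤
        {h | GoodRun D O α r h}ᶜ.indicator (fun _ => 1) h + η := by
      have hw := sum_weights_ne_zero hk hO α r h
      have := isProbabilityMeasure_mixture D _ hw
      have hprob : IsProbabilityMeasure (roundLaw D m n (weights O α r h)) := by
        unfold roundLaw
        infer_instance
      have hsnoc : Measurable fun ρ : RoundData X k m n =>
          (Fin.snoc (α := fun _ => RoundData X k m n) h ρ : Fin (r + 1) → RoundData X k m n) := by
        refine measurable_pi_lambda _ fun j => ?_
        refine Fin.lastCases ?_ (fun s => ?_) j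
        · simpa using! measurable_id
        · simp
      rw [Measure.map_apply hsnoc hm]
      by_cases hg : GoodRun D O α r h
      · refine le_add_left ((measure_mono fun ρ hρ => ?_).trans (hη _ hw))
        simpa [GoodRun, hg] using hρ
      · rw [Set.indicator_of_mem (by exact hg)]
        exact le_add_right prob_le_one
    refine (lintegral_mono hpt).trans ?_
    rw [lintegral_add_right _ measurable_const, lintegral_indicator_const hm0]
    simp only [one_mul, lintegral_const, measure_univ, mul_one]
    push_cast
    rw [add_mul, one_mul]
    exact add_le_add_left ih _

/-! ### Deterministic analysis of a good run -/

lemma GoodRun.err_le {D : Fin k → Measure (Example X)} {m n r : ℕ} {α : ℝ}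
    {h : Fin r → RoundData X k m n} (hg : GoodRun D O α r h) (s : Fin r) {i : Fin k}
    (hi : i ∈ passed O α (h s)) : err (D i) (roundClassifier O (h s)) ≤ α := by
  induction r with
  | zero => exact s.elim0
  | succ r ih =>
    induction s using Fin.lastCases with
    | last =>
      by_contra hlt
      exact hg.2 (Or.inr ⟨i, Or.inl ⟨not_le.1 hlt, hi⟩⟩)
    | cast s => exact ih hg.1 s hi

lemma GoodRun.sum_weights_le {D : Fin k → Measure (Example X)} {m n r : ℕ} {α : ℝ} (hα : 0 < α)
    {h : Fin r → RoundData X k m n} (hg : GoodRun D O α r h) :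
    ∑ i, (weights O α r h i : ℝ) ≤ k * (9 / 8) ^ r := by
  induction r with
  | zero => simp [weights]
  | succ r ih =>
    obtain ⟨hg0, hf⟩ := hg
    have ih := ih hg0
    set w := weights O α r fun s => h s.castSucc with hw
    set f := roundClassifier O (h (Fin.last r))
    simp only [RoundFails, not_or, not_lt, not_exists] at hf
    -- Markov's inequality in linear form: a failing player has `2/α · err ≥ 1`, which pays for the
    -- doubling, and a passing player pays a nonnegative amount.
    have hstep (i : Fin k) : (weights O α (r + 1) h i : ℝ) ≤ w i + 2 / α * (w i * err (D i) f) := by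
      have h0 : (0 : ℝ) ≤ w i := (w i).2
      have he : 0 ≤ err (D i) f := measureReal_nonneg
      by_cases hi : i ∈ passed O α (h (Fin.last r))
      · simp only [weights, hi, not_true_eq_false, if_false, ← hw]
        have : 0 ≤ 2 / α * (w i * err (D i) f) := by positivity
        linarith
      · simp only [weights, hi, not_false_eq_true, if_true, ← hw, NNReal.coe_mul]
        have h1 : α / 2 ≤ err (D i) f := by
          by_contra hlt
          exact (hf.2 i).2 ⟨(not_le.1 hlt).le, hi⟩
        have h2 : 1 ≤ 2 / α * err (D i) f := by
          rw [div_mul_eq_mul_div, le_div_iff₀ hα]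
          linarith
        have h3 := mul_le_mul_of_nonneg_left h2 h0
        simp only [NNReal.coe_ofNat]
        linarith
    calc ∑ i, (weights O α (r + 1) h i : ℝ)
        ≤ ∑ i, ((w i : ℝ) + 2 / α * (w i * err (D i) f)) := Finset.sum_le_sum fun i _ => hstep i
      _ = ∑ i, (w i : ℝ) + 2 / α * ∑ i, w i * err (D i) f := by
          rw [Finset.sum_add_distrib, Finset.mul_sum]
      _ ≤ ∑ i, (w i : ℝ) + 2 / α * (α / 16 * ∑ i, (w i : ℝ)) := by
          have := hf.1
          gcongr
      _ = 9 / 8 * ∑ i, (w i : ℝ) := by field_simp; ring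
      _ ≤ k * (9 / 8) ^ (r + 1) := by rw [pow_succ]; linarith

open Classical in
lemma GoodRun.card_not_passed_le {D : Fin k → Measure (Example X)} {m n q : ℕ} {α : ℝ} (hα : 0 < α)
    (hk : k ≤ 2 ^ q) {h : Fin (5 * q) → RoundData X k m n}
    (hg : GoodRun D O α (5 * q) h) (i : Fin k) :
    (Finset.univ.filter fun s => i ∉ passed O α (h s)).card ≤ 2 * q := by
  have h1 := hg.sum_weights_le hα
  have h2 : (weights O α (5 * q) h i : ℝ) ≤ ∑ i, (weights O α (5 * q) h i : ℝ) :=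
    Finset.single_le_sum (f := fun i => (weights O α (5 * q) h i : ℝ)) (fun i _ => NNReal.coe_nonneg _)
      (Finset.mem_univ i)
  rw [weights_eq_pow] at h2
  push_cast at h2
  have h3 : (k : ℝ) ≤ 2 ^ q := by exact_mod_cast hk
  have h4 : (k : ℝ) * (9 / 8) ^ (5 * q) ≤ 2 ^ (2 * q) := by
    rw [pow_mul, pow_mul (2 : ℝ)]
    -- Here the factor 5 in the number of rounds is used: `(9/8)^5 < 2`.
    calc (k : ℝ) * ((9 / 8) ^ 5) ^ q ≤ 2 ^ q * 2 ^ q := by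
          refine mul_le_mul h3 (pow_le_pow_left₀ (by positivity) (by norm_num) q) (by positivity)
            (by positivity)
      _ = (2 ^ 2) ^ q := by rw [← mul_pow]; norm_num
  exact (pow_le_pow_iff_right₀ (by norm_num : (1 : ℝ) < 2)).1 (h2.trans (h1.trans h4))

end Execution

/-- If at least three fifths of the classifiers have error at most `α`, then their majority vote
has error at most `6 α`. -/
lemma err_maj_le {X : Type*} [MeasurableSpace X] (D : Measure (Example X)) [IsProbabilityMeasure D]
    {q : ℕ} (hq : q ≠ 0) {f : Fin (5 * q) → X → Bool}
    (hf : ∀ s, MeasurableSet {z : Example X | f s z.1 ≠ z.2}) {α : ℝ}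
    {G : Finset (Fin (5 * q))} (hG : 3 * q ≤ G.card) (hGα : ∀ s ∈ G, err D (f s) ≤ α) :
    err D (maj f) ≤ 6 * α := by
  classical
  -- Exactly `3q` good classifiers are kept, so only `2q` lie outside `H`; of the at least `5q/2`
  -- wrong votes, `q/2` then fall in `H`.
  obtain ⟨H, hHG, hH⟩ := Finset.exists_subset_card_eq hG
  let E : Fin (5 * q) → Set (Example X) := fun s => {z | f s z.1 ≠ z.2}
  have hint (s) : Integrable ((E s).indicator fun _ => (1 : ℝ)) D :=
    (integrable_const _).indicator (hf s)
  have hsum (z : Example X) : ∑ s ∈ H, (E s).indicator (fun _ => (1 : ℝ)) z =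
      (H.filter fun s => f s z.1 ≠ z.2).card := by
    simp [Finset.card_filter, Set.indicator_apply, E]
  have hmaj : {z : Example X | maj f z.1 ≠ z.2} ⊆
      {z | (q : ℝ) / 2 ≤ ∑ s ∈ H, (E s).indicator (fun _ => (1 : ℝ)) z} := by
    intro z hz
    -- The inequality is weak because a tie gives the label 0, which is wrong when the true label is
    -- 1.
    have hall : 5 * q ≤ 2 * (Finset.univ.filter fun s => f s z.1 ≠ z.2).card := by
      have hz' : maj f z.1 ≠ z.2 := hz
      unfold maj at hz'
      have hc := Finset.card_filter_add_card_filter_not (s := Finset.univ)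
        fun s : Fin (5 * q) => f s z.1 = true
      simp only [Finset.card_univ, Fintype.card_fin] at hc
      cases hy : z.2 <;> simp [hy] at hz' hc ⊢ <;> omega
    have hsplit : (Finset.univ.filter fun s => f s z.1 ≠ z.2).card ≤
        (H.filter fun s => f s z.1 ≠ z.2).card + Hᶜ.card := by
      refine le_trans (Finset.card_le_card fun s hs => ?_) (Finset.card_union_le _ _)
      by_cases hsH : s ∈ H <;> simp_all
    rw [Finset.card_compl, Fintype.card_fin, hH] at hsplit
    have : q ≤ 2 * (H.filter fun s => f s z.1 ≠ z.2).card := by omega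
    have h2 : (q : ℝ) ≤ 2 * (H.filter fun s => f s z.1 ≠ z.2).card := by exact_mod_cast this
    change (q : ℝ) / 2 ≤ ∑ s ∈ H, (E s).indicator (fun _ => (1 : ℝ)) z
    rw [hsum]
    linarith
  have hmarkov := mul_meas_ge_le_integral_of_nonneg (μ := D)
    (f := fun z => ∑ s ∈ H, (E s).indicator (fun _ => (1 : ℝ)) z)
    (Filter.Eventually.of_forall fun z => by
      change (0 : ℝ) ≤ ∑ s ∈ H, (E s).indicator (fun _ => (1 : ℝ)) z
      rw [hsum]
      exact Nat.cast_nonneg _)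
    (integrable_finsetSum _ fun s _ => hint s) ((q : ℝ) / 2)
  rw [integral_finsetSum _ fun s _ => hint s] at hmarkov
  have hE (s) : ∫ z, (E s).indicator (fun _ => (1 : ℝ)) z ∂D = err D (f s) := by
    rw [integral_indicator_const _ (hf s)]
    simp [err]
  simp only [hE] at hmarkov
  have h3 : ∑ s ∈ H, err D (f s) ≤ 3 * q * α := by
    refine (Finset.sum_le_card_nsmul H _ α fun s hs => hGα s (hHG hs)).trans ?_
    simp [hH]
  have h4 : err D (maj f) ≤
      D.real {z | (q : ℝ) / 2 ≤ ∑ s ∈ H, (E s).indicator (fun _ => (1 : ℝ)) z} :=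
    measureReal_mono hmaj
  have hq0 : (0 : ℝ) < q := by exact_mod_cast Nat.pos_of_ne_zero hq
  have h5 : (q : ℝ) / 2 * err D (maj f) ≤ 3 * q * α :=
    (mul_le_mul_of_nonneg_left h4 (by positivity)).trans (hmarkov.trans h3)
  nlinarith

/-! ### Parameters and the correctness of Algorithm R1 -/

lemma ceil_logb_pos {k : ℕ} (hk : 2 ≤ k) : 0 < ⌈Real.logb 2 k⌉₊ :=
  Nat.ceil_pos.2 (Real.logb_pos (by norm_num) (by exact_mod_cast hk))

lemma rounds_pos {k : ℕ} (hk : 2 ≤ k) : 0 < rounds k :=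
  Nat.mul_pos (by norm_num) (ceil_logb_pos hk)

lemma le_two_pow_ceil_logb {k : ℕ} (hk : k ≠ 0) : k ≤ 2 ^ ⌈Real.logb 2 k⌉₊ := by
  have hk0 : (0 : ℝ) < k := by exact_mod_cast Nat.pos_of_ne_zero hk
  have h1 : (k : ℝ) ≤ (2 : ℝ) ^ ((⌈Real.logb 2 k⌉₊ : ℕ) : ℝ) := by
    rw [← Real.logb_le_iff_le_rpow (by norm_num) hk0]
    exact Nat.le_ceil _
  rw [Real.rpow_natCast] at h1
  exact_mod_cast h1

lemma delta'_pos {k : ℕ} (hk : 2 ≤ k) {δ : ℝ} (hδ : 0 < δ) : 0 < delta' k δ := by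
  have : (0 : ℝ) < rounds k := by exact_mod_cast rounds_pos hk
  unfold delta'
  positivity

lemma rounds_mul_delta' {k : ℕ} (hk : 2 ≤ k) (δ : ℝ) : rounds k * delta' k δ = δ / 3 := by
  have : (0 : ℝ) < rounds k := by exact_mod_cast rounds_pos hk
  unfold delta'
  field_simp

lemma delta'_le_one {k : ℕ} (hk : 2 ≤ k) {δ : ℝ} (hδ1 : δ ≤ 1) : delta' k δ ≤ 1 := by
  have h1 := rounds_mul_delta' hk δ
  have h2 : (1 : ℝ) ≤ rounds k := by exact_mod_cast rounds_pos hk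
  nlinarith

/-- The test samples are so large that all players together spoil a round with probability at most
`δ'`. -/
lemma mul_exp_testSize_le {c ε δ : ℝ} (hc : 32 ≤ c) (hε : 0 < ε) (hδ : 0 < δ) (hδ1 : δ ≤ 1) {k : ℕ}
    (hk : 2 ≤ k) :
    k * Real.exp (-(eps' ε * testSize c k ε δ / 32)) ≤ delta' k δ := by
  have hα : 0 < eps' ε := by unfold eps'; positivity
  have hδ' := delta'_pos hk hδ
  have hk0 : (0 : ℝ) < k := by exact_mod_cast (by omega : 0 < k)
  have hL : 0 ≤ Real.log (k / delta' k δ) := by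
    refine Real.log_nonneg ?_
    rw [le_div_iff₀ hδ']
    have : (1 : ℝ) ≤ k := by exact_mod_cast (by omega : 1 ≤ k)
    linarith [delta'_le_one hk hδ1]
  have hn : c / eps' ε * Real.log (k / delta' k δ) ≤ testSize c k ε δ := Nat.le_ceil _
  rw [div_mul_eq_mul_div, div_le_iff₀ hα] at hn
  have h1 : Real.log (k / delta' k δ) ≤ eps' ε * testSize c k ε δ / 32 := by nlinarith
  calc k * Real.exp (-(eps' ε * testSize c k ε δ / 32))
      ≤ k * Real.exp (-Real.log (k / delta' k δ)) := by gcongr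
    _ = delta' k δ := by
        rw [Real.exp_neg, Real.exp_log (by positivity)]
        field_simp

lemma lawR1_err_le {X : Type*} [MeasurableSpace X] {F : Set (X → Bool)} {d : ℕ} (hd : vcDim F = d)
    {O : Learner X} (hO : IsERM F O) {k : ℕ} (hk : 2 ≤ k) (D : Fin k → Measure (Example X))
    [∀ i, IsProbabilityMeasure (D i)] {f : X → Bool} (hf : f ∈ F) (hfD : ∀ i, err (D i) f = 0)
    {C c ε δ : ℝ} (hC : 8 ≤ C) (hc : 32 ≤ c) (hε : 0 < ε) (hε1 : ε < 1) (hδ : 0 < δ) (hδ1 : δ < 1) :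
    1 - δ ≤ (lawR1 D O C c d ε δ).real {h | ∀ i, err (D i) (outputR1 O h) ≤ ε} := by
  classical
  have hk0 : k ≠ 0 := by omega
  have hα : 0 < eps' ε := by unfold eps'; positivity
  have hα1 : eps' ε ≤ 1 := by unfold eps'; linarith
  have hδ' := delta'_pos hk hδ
  have hη (w : Fin k → ℝ≥0) (hw : ∑ i, w i ≠ 0) :
      roundLaw D (learnSize C d k ε δ) (testSize c k ε δ) w {ρ | RoundFails D O (eps' ε) w ρ} ≤
        ENNReal.ofReal (2 * delta' k δ) := by
    refine (roundLaw_fails_le D hO hd hf hfD hC hα hα1 hδ' (delta'_le_one hk hδ1.le) _ w hw).trans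
      (ENNReal.ofReal_le_ofReal ?_)
    -- One `δ'` is spent on learning and one on all the tests together.
    linarith [mul_exp_testSize_le hc hε hδ hδ1.le hk]
  have hbad := law_not_goodRun_le D hk0 hO hη (rounds k)
  have hprob : IsProbabilityMeasure (lawR1 D O C c d ε δ) :=
    (law_wellDefined hk0 D hO _ _ _ _).2
  have hgm := measurableSet_goodRun (m := learnSize C d k ε δ) (n := testSize c k ε δ) D hO (eps' ε)
    (rounds k)
  have hgood : 1 - δ ≤ (lawR1 D O C c d ε δ).real {h | GoodRun D O (eps' ε) (rounds k) h} := by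
    change (lawR1 D O C c d ε δ) {h | GoodRun D O (eps' ε) (rounds k) h}ᶜ ≤ _ at hbad
    rw [← ofReal_measureReal, ← ENNReal.ofReal_natCast, ← ENNReal.ofReal_mul (Nat.cast_nonneg _),
      ENNReal.ofReal_le_ofReal_iff (by positivity), probReal_compl_eq_one_sub hgm] at hbad
    linarith [rounds_mul_delta' hk δ]
  refine hgood.trans (measureReal_mono fun h hg i => ?_)
  have hfail := GoodRun.card_not_passed_le (q := ⌈Real.logb 2 k⌉₊) hα (le_two_pow_ceil_logb hk0)
    (h := h) hg i
  have hsplit := Finset.card_filter_add_card_filter_not (s := Finset.univ)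
    fun s : Fin (5 * ⌈Real.logb 2 k⌉₊) => i ∈ passed O (eps' ε) (h s)
  rw [Finset.card_univ, Fintype.card_fin] at hsplit
  have hmaj := err_maj_le (D i) (ceil_logb_pos hk).ne' (f := fun s => roundClassifier O (h s))
    (fun s => measurableSet_classifier_ne hO (h s).1) (α := eps' ε)
    (G := Finset.univ.filter fun s => i ∈ passed O (eps' ε) (h s)) (by omega)
    (fun s hs => GoodRun.err_le hg s (Finset.mem_filter.1 hs).2)
  have h6 : 6 * eps' ε = ε := by unfold eps'; ring
  rw [h6] at hmaj
  exact hmaj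

/-! ### The number of examples -/

/-- Both `log₂ k` and the 1 lost in rounding are at most `2 ln k`, because `ln 2 > 1/2`; hence `5(2
+ 2) = 20`. -/
lemma rounds_le {k : ℕ} (hk : 2 ≤ k) : (rounds k : ℝ) ≤ 20 * Real.log k := by
  have hk2 : (2 : ℝ) ≤ k := by exact_mod_cast hk
  have hlog2 : 1 / 2 < Real.log 2 := by linarith [Real.log_two_gt_d9]
  have hlogk : Real.log 2 ≤ Real.log k := Real.log_le_log (by norm_num) hk2
  have h1 : (⌈Real.logb 2 k⌉₊ : ℝ) < Real.logb 2 k + 1 :=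
    Nat.ceil_lt_add_one (Real.logb_nonneg (by norm_num) (by linarith))
  have h2 : Real.logb 2 k ≤ 2 * Real.log k := by
    rw [Real.logb, div_le_iff₀ (by linarith)]
    nlinarith
  unfold rounds
  push_cast
  linarith

lemma one_half_le_log_div {k : ℕ} (hk : 2 ≤ k) {δ : ℝ} (hδ : 0 < δ) (hδ1 : δ ≤ 1) :
    1 / 2 ≤ Real.log (k / δ) := by
  have hk2 : (2 : ℝ) ≤ k := by exact_mod_cast hk
  have h1 : Real.log 2 ≤ Real.log (k / δ) := by
    refine Real.log_le_log (by norm_num) ?_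
    rw [le_div_iff₀ hδ]
    nlinarith
  linarith [Real.log_two_gt_d9]

lemma log_one_div_delta'_le {k : ℕ} (hk : 2 ≤ k) {δ : ℝ} (hδ : 0 < δ) (hδ1 : δ ≤ 1) :
    Real.log (1 / delta' k δ) ≤ 7 * Real.log (k / δ) := by
  have hk2 : (2 : ℝ) ≤ k := by exact_mod_cast hk
  have hr : (0 : ℝ) < rounds k := by exact_mod_cast rounds_pos hk
  have h1 : Real.log k ≤ k := (Real.log_le_sub_one_of_pos (by linarith)).trans (by linarith)
  -- `3t ≤ 60 ln k ≤ 60 k ≤ 2^6 k ≤ k^7`, which is the source of the exponent 7.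
  have h2 : 3 * (rounds k : ℝ) ≤ (k : ℝ) ^ 7 := by
    have h6 : (2 : ℝ) ^ 6 ≤ (k : ℝ) ^ 6 := pow_le_pow_left₀ (by norm_num) hk2 6
    have : (k : ℝ) ^ 7 = k ^ 6 * k := by ring
    nlinarith [rounds_le hk]
  have h3 : 1 / delta' k δ ≤ (k / δ) ^ 7 := by
    unfold delta'
    rw [one_div_div, div_pow]
    refine div_le_div₀ (by positivity) h2 (by positivity) ?_
    exact pow_le_of_le_one hδ.le hδ1 (by norm_num)
  have h4 := Real.log_le_log (one_div_pos.2 (delta'_pos hk hδ)) h3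
  rwa [Real.log_pow] at h4

lemma log_div_delta'_le {k : ℕ} (hk : 2 ≤ k) {δ : ℝ} (hδ : 0 < δ) (hδ1 : δ ≤ 1) :
    Real.log (k / delta' k δ) ≤ 8 * Real.log (k / δ) := by
  have hk2 : (2 : ℝ) ≤ k := by exact_mod_cast hk
  have hδ' := delta'_pos hk hδ
  have h1 : Real.log k ≤ Real.log (k / δ) := by
    refine Real.log_le_log (by linarith) ?_
    rw [le_div_iff₀ hδ]
    nlinarith
  rw [div_eq_mul_one_div, Real.log_mul (by linarith) (by positivity)]
  linarith [log_one_div_delta'_le hk hδ hδ1]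

/-- Absorbs the 1 lost in rounding up into the confidence term; it is applied with `b = log(k/δ) ≥
1/2`. -/
lemma natCeil_le_of_one_le_two_mul {a b ε : ℝ} (ha : 0 ≤ a) (hε : 0 < ε) (hε1 : ε ≤ 1)
    (hb : 1 / 2 ≤ b) : (⌈a⌉₊ : ℝ) ≤ a + 2 / ε * b := by
  have h1 : 1 ≤ 2 / ε * b := by
    rw [div_mul_eq_mul_div, le_div_iff₀ hε]
    linarith
  linarith [Nat.ceil_lt_add_one ha]

lemma testSize_le {c : ℝ} (hc : 0 ≤ c) {k : ℕ} (hk : 2 ≤ k) {ε δ : ℝ} (hε : 0 < ε) (hε1 : ε ≤ 1)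
    (hδ : 0 < δ) (hδ1 : δ ≤ 1) :
    (testSize c k ε δ : ℝ) ≤ (48 * c + 2) / ε * Real.log (k / δ) := by
  have hb := one_half_le_log_div hk hδ hδ1
  have hα : 0 < eps' ε := by unfold eps'; positivity
  have hL : 0 ≤ Real.log (k / delta' k δ) := by
    have hk1 : (1 : ℝ) ≤ k := by exact_mod_cast (by omega : 1 ≤ k)
    refine Real.log_nonneg ?_
    rw [le_div_iff₀ (delta'_pos hk hδ)]
    linarith [delta'_le_one hk hδ1]
  refine (natCeil_le_of_one_le_two_mul (by positivity) hε hε1 hb).trans ?_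
  have h1 : c / eps' ε * Real.log (k / delta' k δ) ≤ c / eps' ε * (8 * Real.log (k / δ)) :=
    mul_le_mul_of_nonneg_left (log_div_delta'_le hk hδ hδ1) (by positivity)
  refine (add_le_add_left h1 _).trans (le_of_eq ?_)
  unfold eps'
  field_simp
  ring

/-- The accuracy is `ε/96`, so its logarithm is `log 96 + log(1/ε)`. The constant `log 96` is a
bounded multiple of `log(1/ε)` only when `ε` stays away from 1, hence the dependence on `ε₀`. Also
`672 = 96 · 7`. -/
lemma learnSize_le {C : ℝ} (hC : 0 ≤ C) {ε₀ : ℝ} (hε₀1 : ε₀ < 1) (d : ℕ) {k : ℕ} (hk : 2 ≤ k)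
    {ε δ : ℝ} (hε : 0 < ε) (hε1 : ε ≤ ε₀) (hδ : 0 < δ) (hδ1 : δ ≤ 1) :
    (learnSize C d k ε δ : ℝ) ≤
      96 * C * (Real.log 96 / Real.log (1 / ε₀) + 1) / ε * (d * Real.log (1 / ε)) +
        (672 * C + 2) / ε * Real.log (k / δ) := by
  have hb := one_half_le_log_div hk hδ hδ1
  have hε₀ : 0 < ε₀ := hε.trans_le hε1
  have hα : 0 < eps' ε / 16 := by unfold eps'; positivity
  have hα1 : eps' ε / 16 ≤ 1 := by unfold eps'; linarith
  have hl0 : 0 < Real.log (1 / ε₀) := Real.log_pos (by rw [lt_div_iff₀ hε₀]; linarith)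
  have hl : Real.log (1 / ε₀) ≤ Real.log (1 / ε) :=
    Real.log_le_log (by positivity) (one_div_le_one_div_of_le hε hε1)
  have h96 : 0 ≤ Real.log 96 := Real.log_nonneg (by norm_num)
  have h1 : Real.log (1 / (eps' ε / 16)) ≤
      (Real.log 96 / Real.log (1 / ε₀) + 1) * Real.log (1 / ε) := by
    have h2 : 1 / (eps' ε / 16) = 96 * (1 / ε) := by unfold eps'; field_simp; norm_num
    rw [h2, Real.log_mul (by norm_num) (by positivity), add_mul, one_mul]
    refine add_le_add_left ?_ _
    rw [div_mul_eq_mul_div, le_div_iff₀ hl0]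
    exact mul_le_mul_of_nonneg_left hl h96
  have hL1 : 0 ≤ Real.log (1 / (eps' ε / 16)) :=
    Real.log_nonneg (by rw [le_div_iff₀ hα]; linarith)
  have hL2 : 0 ≤ Real.log (1 / delta' k δ) := by
    refine Real.log_nonneg ?_
    rw [le_div_iff₀ (delta'_pos hk hδ)]
    linarith [delta'_le_one hk hδ1]
  refine (natCeil_le_of_one_le_two_mul (by positivity) hε (by linarith) hb).trans ?_
  have h3 : C / (eps' ε / 16) * (d * Real.log (1 / (eps' ε / 16)) + Real.log (1 / delta' k δ)) ≤
      C / (eps' ε / 16) * (d * ((Real.log 96 / Real.log (1 / ε₀) + 1) * Real.log (1 / ε)) +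
        7 * Real.log (k / δ)) := by
    have := log_one_div_delta'_le hk hδ hδ1
    gcongr
  refine (add_le_add_left h3 _).trans (le_of_eq ?_)
  have h4 : C / (eps' ε / 16) = 96 * C / ε := by unfold eps'; field_simp; ring
  rw [h4]
  ring

lemma samplesR1_le {C c : ℝ} (hC : 0 ≤ C) (hc : 0 ≤ c) {ε₀ : ℝ} (hε₀ : 0 < ε₀) (hε₀1 : ε₀ < 1) :
    ∃ K : ℝ, 0 < K ∧ ∀ d k : ℕ, 2 ≤ k → ∀ ε δ : ℝ, 0 < ε → ε ≤ ε₀ → 0 < δ → δ < 1 →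
      (samplesR1 C c d k ε δ : ℝ) ≤
        K * (Real.log k / ε * (d * Real.log (1 / ε) + k * Real.log (k / δ))) := by
  have hl0 : 0 < Real.log (1 / ε₀) := Real.log_pos (by rw [lt_div_iff₀ hε₀]; linarith)
  have h96 : 0 ≤ Real.log 96 := Real.log_nonneg (by norm_num)
  set A := 96 * C * (Real.log 96 / Real.log (1 / ε₀) + 1) with hA
  have hA0 : 0 ≤ A := by positivity
  -- The sum of the coefficients `672 C + 2` from learning and `48 c + 2` from testing; the former
  -- is multiplied by only one `log(k/δ)`, which is at most `k log(k/δ)`.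
  set B := 672 * C + 48 * c + 4 with hB
  have hB0 : 0 < B := by positivity
  refine ⟨20 * (A + B), by positivity, fun d k hk ε δ hε hε1 hδ hδ1 => ?_⟩
  have hk1 : (1 : ℝ) ≤ k := by exact_mod_cast (by omega : 1 ≤ k)
  have hb := one_half_le_log_div hk hδ hδ1.le
  have hL := learnSize_le hC hε₀1 d hk hε hε1 hδ hδ1.le
  have hT := testSize_le hc hk hε (hε1.trans hε₀1.le) hδ hδ1.le
  rw [← hA] at hL
  have hu : 0 ≤ d * Real.log (1 / ε) :=
    mul_nonneg (Nat.cast_nonneg d) (Real.log_nonneg (by rw [le_div_iff₀ hε]; linarith))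
  have hlogk : 0 ≤ Real.log k := Real.log_nonneg hk1
  have hround : (learnSize C d k ε δ : ℝ) + k * testSize c k ε δ ≤
      (A + B) / ε * (d * Real.log (1 / ε) + k * Real.log (k / δ)) := by
    set u := d * Real.log (1 / ε)
    set v := Real.log (k / δ)
    have hv : v ≤ k * v := le_mul_of_one_le_left (by linarith) hk1
    have h1 : (672 * C + 2) / ε * v ≤ (672 * C + 2) / ε * (k * v) :=
      mul_le_mul_of_nonneg_left hv (by positivity)
    have h2 : (k : ℝ) * testSize c k ε δ ≤ k * ((48 * c + 2) / ε * v) :=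
      mul_le_mul_of_nonneg_left hT (by linarith)
    have h3 : 0 ≤ A / ε * (k * v) := by positivity
    have h4 : 0 ≤ B / ε * u := by positivity
    have h5 : (A + B) / ε * (u + k * v) = A / ε * u + (672 * C + 2) / ε * (k * v) +
        k * ((48 * c + 2) / ε * v) + A / ε * (k * v) + B / ε * u := by
      rw [hB]
      ring
    linarith
  have hs : (samplesR1 C c d k ε δ : ℝ) =
      rounds k * ((learnSize C d k ε δ : ℝ) + k * testSize c k ε δ) := by
    simp [samplesR1]
  rw [hs]
  calc (rounds k : ℝ) * ((learnSize C d k ε δ : ℝ) + k * testSize c k ε δ)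
      ≤ 20 * Real.log k * ((A + B) / ε * (d * Real.log (1 / ε) + k * Real.log (k / δ))) :=
        mul_le_mul (rounds_le hk) hround (by positivity) (by positivity)
    _ = _ := by ring

end CollabPAC

theorem theorem1 :
    ∃ C₀ : ℝ, 0 < C₀ ∧ ∀ C : ℝ, C₀ ≤ C → ∀ c : ℝ, 32 ≤ c →
      (∀ (X : Type*) [MeasurableSpace X] (F : Set (X → Bool)) (d : ℕ), CollabPAC.vcDim F = d →
        ∀ O : CollabPAC.Learner X, CollabPAC.IsERM F O →
        ∀ k : ℕ, 2 ≤ k →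
        ∀ (D : Fin k → Measure (CollabPAC.Example X)) [∀ i, IsProbabilityMeasure (D i)],
        (∃ f ∈ F, ∀ i, CollabPAC.err (D i) f = 0) →
        ∀ ε δ : ℝ, 0 < ε → ε < 1 → 0 < δ → δ < 1 →
          1 - δ ≤ (CollabPAC.lawR1 D O C c d ε δ).real
            {h | ∀ i, CollabPAC.err (D i) (CollabPAC.outputR1 O h) ≤ ε}) ∧
      (∀ ε₀ : ℝ, 0 < ε₀ → ε₀ < 1 → ∃ K : ℝ, 0 < K ∧
        ∀ d k : ℕ, 2 ≤ k → ∀ ε δ : ℝ, 0 < ε → ε ≤ ε₀ → 0 < δ → δ < 1 →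
          (CollabPAC.samplesR1 C c d k ε δ : ℝ) ≤
            K * (Real.log k / ε * (d * Real.log (1 / ε) + k * Real.log (k / δ)))) := by
  -- The value 8 is what `learner_err_gt_le` requires of the learning constant.
  refine ⟨8, by norm_num, fun C hC c hc => ⟨?_, fun ε₀ hε₀ hε₀1 =>
    CollabPAC.samplesR1_le (by linarith) (by linarith) hε₀ hε₀1⟩⟩
  intro X _ F d hd O hO k hk D _ hreal ε δ hε hε1 hδ hδ1
  obtain ⟨f, hf, hfD⟩ := hreal
  exact CollabPAC.lawR1_err_le hd hO hk D hf hfD hC hc hε hε1 hδ hδ1
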